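/- Let $d\ge 1$, $\alpha\in(0,2)$, $\varepsilon>1$, and $$V(x)=\tfrac d2\log(1+|x|^2)+\varepsilon\log\log(\mathrm e+|x|^2),\qquad x\in\mathbb R^d .$$ Then $\mu_V(\mathrm dx):=\big(\int_{\mathbb R^d}\mathrm e^{-V(z)}\,\mathrm dz\big)^{-1}\mathrm e^{-V(x)}\,\mathrm dx$ is a probability measure. Put $$\mathcal E_{\alpha,V}(f,g):=\iint_{\mathbb R^d\times\mathbb R^d}\frac{(f(x)-f(y))(g(x)-g(y))}{|x-y|^{d+\alpha}}\,\mathrm dy\,\mu_V(\mathrm dx),\qquad \mathcal D(\mathcal E_{\alpha,V}):=\{f\in L^2(\mu_V):\mathcal E_{\alpha,V}(f,f)<\infty\}.$$ For $\tilde\beta:(0,\infty)\to(0,\infty)$ consider the weak Poincaré inequality $$\mu_V(f^2)\le\tilde\beta(r)\,\mathcal E_{\alpha,V}(f,f)+r\|f\|_\infty^2\qquad\text{for all } r>0,\ f\in\mathcal D(\mathcal E_{\alpha,V})\text{ with }\mu_V(f)=0. \tag{WP}$$ (1) There exist constants $c_1,c_2>0$ such that (WP) holds with $\tilde\beta(r)=c_1\exp\big[c_2r^{-1/(\varepsilon-1)}\big]$.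 (2) There is exactly one strongly continuous semigroup $(P_t)_{t\ge0}$ of bounded operators on $L^2(\mu_V)$ associated with $\mathcal E_{\alpha,V}$, that is, whose generator $L$ is given by: $f\in\mathrm{Dom}(L)$ and $Lf=g$ if and only if $f\in\mathcal D(\mathcal E_{\alpha,V})$ and $\mathcal E_{\alpha,V}(f,h)=-\mu_V(gh)$ for all $h\in\mathcal D(\mathcal E_{\alpha,V})$. For this semigroup there is a constant $\lambda>0$ such that $$\|P_t-\mu_V\|_{L^\infty(\mu_V)\to L^2(\mu_V)}^2\le\lambda\,[\log(1+t)]^{1-\varepsilon},\qquad t>0,$$ where $\mu_V$ also denotes the operator $f\mapsto\mu_V(f)$. (3) The rate in (1) is sharp: (WP) does not hold for any $\tilde\beta:(0,\infty)\to(0,\infty)$ with $\lim_{r\to0}r^{1/(\varepsilon-1)}\log\tilde\beta(r)=0$. All constants may depend on $d$, $\alpha$ and $\varepsilon$. -/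

import Mathlib

open MeasureTheory Filter Topology
open scoped ENNReal NNReal

noncomputable section

namespace StableLike

/-- The normalized measure `μ_V(dx) = e^{-V(x)} dx / ∫ e^{-V(x)} dx` on `ℝ^d`. -/
def mu {d : ℕ} (V : EuclideanSpace ℝ (Fin d) → ℝ) : Measure (EuclideanSpace ℝ (Fin d)) :=
  (∫⁻ x, ENNReal.ofReal (Real.exp (-V x)))⁻¹ •
    (volume : Measure (EuclideanSpace ℝ (Fin d))).withDensity
      (fun x => ENNReal.ofReal (Real.exp (-V x)))

/-- The energy `𝓔_{α,V}(f,f) = ∬ |f(x)-f(y)|² / |x-y|^{d+α} dy μ_V(dx)`, with values in `[0,∞]`.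
In a product point `p = (x, y)`, `p.1 = x` is distributed by `μ_V` and `p.2 = y` by Lebesgue
measure. -/
def energy {d : ℕ} (α : ℝ) (V f : EuclideanSpace ℝ (Fin d) → ℝ) : ℝ≥0∞ :=
  ∫⁻ p, ENNReal.ofReal (|f p.1 - f p.2| ^ 2 / ‖p.1 - p.2‖ ^ ((d : ℝ) + α))
    ∂((mu V).prod volume)

/-- `f ∈ 𝓓(𝓔_{α,V})`: the function `f` is in `L²(μ_V)` and has finite energy. -/
def InDomain {d : ℕ} (α : ℝ) (V f : EuclideanSpace ℝ (Fin d) → ℝ) : Prop :=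
  MemLp f 2 (mu V) ∧ energy α V f < ∞

/-- The bilinear form
`𝓔_{α,V}(f,g) = ∬ (f(x)-f(y)) (g(x)-g(y)) / |x-y|^{d+α} dy μ_V(dx)`;
by Cauchy-Schwarz the integral converges absolutely for `f, g` in the domain, and it is only
used there. -/
def form {d : ℕ} (α : ℝ) (V f g : EuclideanSpace ℝ (Fin d) → ℝ) : ℝ :=
  ∫ p, (f p.1 - f p.2) * (g p.1 - g p.2) / ‖p.1 - p.2‖ ^ ((d : ℝ) + α)
    ∂((mu V).prod volume)

/-- The weak Poincaré inequality with rate function `β`: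
`μ_V(f²) ≤ β(r) 𝓔_{α,V}(f,f) + r ‖f‖_∞²` for all `r > 0` and all `f ∈ 𝓓(𝓔_{α,V})` with
`μ_V(f) = 0`. Here `‖f‖_∞` is the essential supremum norm, and it is `∞` when `f` is unbounded. -/
def WeakPoincare {d : ℕ} (α : ℝ) (V : EuclideanSpace ℝ (Fin d) → ℝ) (β : ℝ → ℝ) : Prop :=
  ∀ r : ℝ, 0 < r → ∀ f : EuclideanSpace ℝ (Fin d) → ℝ,
    InDomain α V f → ∫ x, f x ∂(mu V) = 0 →
      ∫⁻ x, ENNReal.ofReal (f x ^ 2) ∂(mu V) ≤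
        ENNReal.ofReal (β r) * energy α V f + ENNReal.ofReal r * eLpNorm f ∞ (mu V) ^ 2

/-- `P` is the semigroup on `L²(μ_V)` associated with `(𝓔_{α,V}, 𝓓(𝓔_{α,V}))`: a strongly
continuous semigroup of bounded operators whose generator (the derivative from the right at time
zero, with its natural domain) is the operator `L` of the form, where `L f = g` means that
`f ∈ 𝓓(𝓔_{α,V})` and `𝓔_{α,V}(f,h) = -⟨g,h⟩` for all `h ∈ 𝓓(𝓔_{α,V})`. -/
structure IsAssociatedSemigroup {d : ℕ} (α : ℝ) (V : EuclideanSpace ℝ (Fin d) → ℝ)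
    (P : ℝ≥0 → Lp ℝ 2 (mu V) →L[ℝ] Lp ℝ 2 (mu V)) : Prop where
  map_zero : P 0 = ContinuousLinearMap.id ℝ (Lp ℝ 2 (mu V))
  map_add : ∀ s t : ℝ≥0, P (s + t) = (P s).comp (P t)
  strong_continuous : ∀ f : Lp ℝ 2 (mu V), Continuous fun t : ℝ≥0 => P t f
  generator : ∀ f g : Lp ℝ 2 (mu V),
    Tendsto (fun t : ℝ≥0 => (t : ℝ)⁻¹ • (P t f - f)) (𝓝[>] 0) (𝓝 g) ↔
      InDomain α V f ∧ ∀ h : Lp ℝ 2 (mu V), InDomain α V h → form α V f h = -inner ℝ g h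

/-- The operator norm `‖T - μ_V‖` from `L^∞(μ_V)` to `L²(μ_V)`, where `μ_V` also stands for the
operator `f ↦ μ_V(f)`: the supremum of `‖T f - μ_V(f)‖_{L²}` over all `f` with `‖f‖_∞ ≤ 1`. -/
def normSubMean {d : ℕ} (V : EuclideanSpace ℝ (Fin d) → ℝ)
    (T : Lp ℝ 2 (mu V) →L[ℝ] Lp ℝ 2 (mu V)) : ℝ≥0∞ :=
  ⨆ (f : Lp ℝ 2 (mu V)) (_ : eLpNorm f ∞ (mu V) ≤ 1),
    eLpNorm (fun x => T f x - ∫ y, f y ∂(mu V)) 2 (mu V)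

/-- `V(x) = (d/2) log(1+|x|²) + ε log log(e+|x|²)`. -/
def logPotential (d : ℕ) (ε : ℝ) (x : EuclideanSpace ℝ (Fin d)) : ℝ :=
  (d : ℝ) / 2 * Real.log (1 + ‖x‖ ^ 2) + ε * Real.log (Real.log (Real.exp 1 + ‖x‖ ^ 2))

end StableLike

end

/-! Weak Poincaré inequality. For `f` of mean zero, `μ_V(f²)` is at most the double integral of
`(f(x) - f(y))²` against `μ_V ⊗ μ_V`. On pairs inside the ball of radius `R` the kernel `|x -
y|^(-d-α)` is at least `(2R)^(-d-α)`, and since `V ≥ 0` the density of `μ_V` is at most `1/Z`, where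
`Z = ∫ e^(-V)`; these pairs cost at most `(2R)^(d+α) Z⁻¹ 𝓔(f,f)`. The other pairs cost at most `8
μ_V(|x| > R) ‖f‖_∞²`. Far out, `e^(-V)` is comparable to `|x|^(-d) (log |x|)^(-ε)`, so by polar
coordinates the tail is of order `(log R)^(1-ε)`. Making it of size `r` means `log R ≍
r^(-1/(ε-1))`, and `(2R)^(d+α)` becomes the rate (`lintegral_sq_le_energy_add_tail`,
`exists_tail_bounds`).

Sharpness. A centred cutoff at scale `R` has energy at most a constant times `R^(-α)`, because the
kernel is translation invariant in `y` and `μ_V` has mass one, while its variance is at least a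
quarter of the tail beyond `2R`. If `R` is chosen so that this quarter is at least `2r`, then `r ≤
β(r) κ R^(-α)`, which forces `log β(r)` to be at least of order `r^(-1/(ε-1))`
(`WeakPoincare.tail_le`).

Semigroup. The energy is `‖T f‖²` for the closed, densely defined operator `T` taking `f` to its
normalized increment, so the generator is `-T* T`. Its resolvents come from orthogonal projection
onto the graph of a multiple of `T`, and Yosida approximation gives the semigroup; dissipativity
gives uniqueness. The resolvents, hence the semigroup, preserve the closed convex set of mean-zero
functions bounded by `M`. The weak Poincaré inequality therefore applies along orbits with a fixed
sup bound, and Gronwall yields decay `e^(-2t/β(r))` up to an error of order `r`. Choosing `r` with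
`β(r) = c₁ √(1+t)` gives the logarithmic rate (`exists_isAssociatedSemigroup`, `exists_log_decay`).
-/

noncomputable section

namespace StableLike

/-! ### Exponentials of bounded operators -/

section Exponential

variable {H : Type*} [NormedAddCommGroup H] [NormedSpace ℝ H] [CompleteSpace H]

theorem exp_add_clm {A B : H →L[ℝ] H} (h : Commute A B) :
    NormedSpace.exp (A + B) = NormedSpace.exp A * NormedSpace.exp B := by
  let _ : NormedAlgebra ℚ (H →L[ℝ] H) := NormedAlgebra.restrictScalars ℚ ℝ _
  exact NormedSpace.exp_add_of_commute h

/-- Exhibits the exponential as a Poisson mixture of the powers of `J`, with weights `e^(-s) s^n /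
n!`. -/
theorem exp_smul_sub_one (J : H →L[ℝ] H) (s : ℝ) :
    NormedSpace.exp (s • (J - 1)) = Real.exp (-s) • NormedSpace.exp (s • J) := by
  have h1 : s • (J - 1) = algebraMap ℝ (H →L[ℝ] H) (-s) + s • J := by
    rw [Algebra.algebraMap_eq_smul_one, smul_sub, neg_smul]; abel
  rw [h1, exp_add_clm (Algebra.commute_algebraMap_left _ _), ← NormedSpace.algebraMap_exp_comm,
    Algebra.algebraMap_eq_smul_one, smul_one_mul, Real.exp_eq_exp_ℝ]

/-- A closed convex set containing `0` and invariant under `J` is invariant under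
`exp (s (J - 1))` for `s ≥ 0`. -/
theorem exp_smul_sub_one_mem {J : H →L[ℝ] H} {C : Set H} (hC : IsClosed C) (hc : Convex ℝ C)
    (h0 : (0 : H) ∈ C) (hJ : Set.MapsTo J C C) {s : ℝ} (hs : 0 ≤ s) {f : H} (hf : f ∈ C) :
    NormedSpace.exp (s • (J - 1)) f ∈ C := by
  have hpow : ∀ n : ℕ, (J ^ n) f ∈ C := by
    intro n
    induction n with
    | zero => simpa using hf
    | succ n ih => rw [pow_succ']; exact hJ ih
  have hsum := ((NormedSpace.exp_series_hasSum_exp' (𝕂 := ℝ) (s • J)).mapL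
    (ContinuousLinearMap.apply ℝ H f)).const_smul (Real.exp (-s))
  rw [exp_smul_sub_one]
  refine hC.mem_of_tendsto hsum.tendsto_sum_nat (Eventually.of_forall fun N => ?_)
  have hw : ∀ i ∈ Finset.range N, 0 ≤ Real.exp (-s) * (s ^ i / i.factorial) := fun i _ => by
    positivity
  have hle : ∑ i ∈ Finset.range N, Real.exp (-s) * (s ^ i / i.factorial) ≤ 1 := by
    rw [← Finset.mul_sum]
    calc _ ≤ Real.exp (-s) * Real.exp s := by
            gcongr; exact Real.sum_le_exp_of_nonneg hs N
      _ = 1 := by rw [← Real.exp_add]; simp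
  -- A partial sum of the Poisson weights is below one; the missing mass is put on the point `0` of
  -- `C`, at the extra index `N`.
  have key := hc.sum_mem (t := Finset.range (N + 1))
    (w := fun i => if i < N then Real.exp (-s) * (s ^ i / i.factorial)
      else 1 - ∑ i ∈ Finset.range N, Real.exp (-s) * (s ^ i / i.factorial))
    (z := fun i => if i < N then (J ^ i) f else 0)
    (by
      intro i _
      split_ifs
      · positivity
      · linarith)
    (by
      rw [Finset.sum_range_succ, Finset.sum_congr rfl (g := fun i =>
        Real.exp (-s) * (s ^ i / i.factorial)) (fun i hi => if_pos (Finset.mem_range.1 hi))]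
      simp)
    (by
      intro i _
      split_ifs
      · exact hpow i
      · exact h0)
  rw [Finset.sum_range_succ] at key
  simp only [lt_self_iff_false, if_false, smul_zero, add_zero] at key
  convert key using 1
  refine Finset.sum_congr rfl fun i hi => ?_
  have hi' := Finset.mem_range.1 hi
  simp only [hi', if_true, ContinuousLinearMap.apply_apply, smul_pow,
    smul_apply, smul_smul]
  congr 1
  field_simp

/-- Duhamel's formula: the path `e^(tB) e^(s(A-B)) f` joins the two vectors, and by commutation its
velocity is `e^(sA) e^((t-s)B) (A - B) f`, where both exponentials are contractions. -/
theorem norm_exp_smul_sub_exp_smul_le {A B : H →L[ℝ] H} (hAB : Commute A B)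
    (hA : ∀ s : ℝ, 0 ≤ s → ∀ f, ‖NormedSpace.exp (s • A) f‖ ≤ ‖f‖)
    (hB : ∀ s : ℝ, 0 ≤ s → ∀ f, ‖NormedSpace.exp (s • B) f‖ ≤ ‖f‖) {t : ℝ} (ht : 0 ≤ t) (f : H) :
    ‖NormedSpace.exp (t • A) f - NormedSpace.exp (t • B) f‖ ≤ t * ‖A f - B f‖ := by
  set φ : ℝ → H := fun s => NormedSpace.exp (t • B) (NormedSpace.exp (s • (A - B)) f) with hφ
  have hd : ∀ s, HasDerivAt φ (NormedSpace.exp (t • B) ((NormedSpace.exp (s • (A - B)) * (A - B)) f))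
      s := fun s => by
    have h1 := hasDerivAt_exp_smul_const (𝕂 := ℝ) (A - B) s
    exact (NormedSpace.exp (t • B)).hasFDerivAt.comp_hasDerivAt s
      ((ContinuousLinearMap.apply ℝ H f).hasFDerivAt.comp_hasDerivAt s h1)
  have hexp : ∀ s, NormedSpace.exp (t • B) * NormedSpace.exp (s • (A - B)) =
      NormedSpace.exp (s • A) * NormedSpace.exp ((t - s) • B) := fun s => by
    rw [← exp_add_clm, ← exp_add_clm]
    · congr 1
      rw [smul_sub, sub_smul]; abel
    · exact (hAB.smul_left _).smul_right _
    · exact (((hAB.symm).sub_right (Commute.refl B)).smul_left _).smul_right _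
  have hb : ∀ s ∈ Set.Ico 0 t,
      ‖NormedSpace.exp (t • B) ((NormedSpace.exp (s • (A - B)) * (A - B)) f)‖ ≤ ‖A f - B f‖ := by
    intro s hs
    have : NormedSpace.exp (t • B) ((NormedSpace.exp (s • (A - B)) * (A - B)) f) =
      NormedSpace.exp (s • A) (NormedSpace.exp ((t - s) • B) (A f - B f)) := by
      have := congrArg (fun T : H →L[ℝ] H => T (A f - B f)) (hexp s)
      simpa using this
    rw [this]
    exact (hA s hs.1 _).trans (hB _ (by linarith [hs.2]) _)
  have := norm_image_sub_le_of_norm_deriv_le_segment' (f := φ) (a := 0) (b := t)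
    (fun s _ => (hd s).hasDerivWithinAt) hb t ⟨ht, le_rfl⟩
  have h0 : φ 0 = NormedSpace.exp (t • B) f := by simp [hφ, NormedSpace.exp_zero]
  have h1 : φ t = NormedSpace.exp (t • A) f := by
    have := congrArg (fun T : H →L[ℝ] H => T f) (hexp t)
    simpa [NormedSpace.exp_zero] using this
  rw [h0, h1, sub_zero] at this
  linarith

end Exponential

/-! ### Generation of contraction semigroups by Yosida approximation -/

section HilleYosida

variable {H : Type*} [NormedAddCommGroup H] [InnerProductSpace ℝ H]

/-- A dissipative operator, given by its graph `G`, with resolvent family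
`J n = (1 - L / (n + 1))⁻¹` converging strongly to the identity. -/
structure IsMaxDissipative (G : Submodule ℝ (H × H)) (J : ℕ → H →L[ℝ] H) : Prop where
  dissipative : ∀ f g, (f, g) ∈ G → inner ℝ f g ≤ 0
  resolvent_mem : ∀ n f, (J n f, ((n : ℝ) + 1) • (J n f - f)) ∈ G
  tendsto_resolvent : ∀ f, Tendsto (fun n => J n f) atTop (𝓝 f)

/-- `P` is a strongly continuous semigroup whose generator has the graph `G`. -/
structure IsSemigroupOf (G : Submodule ℝ (H × H)) (P : ℝ≥0 → H →L[ℝ] H) : Prop where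
  map_zero : P 0 = ContinuousLinearMap.id ℝ H
  map_add : ∀ s t : ℝ≥0, P (s + t) = (P s).comp (P t)
  strong_continuous : ∀ f : H, Continuous fun t : ℝ≥0 => P t f
  generator : ∀ f g : H,
    Tendsto (fun t : ℝ≥0 => (t : ℝ)⁻¹ • (P t f - f)) (𝓝[>] 0) (𝓝 g) ↔ (f, g) ∈ G

namespace IsMaxDissipative

variable {G : Submodule ℝ (H × H)} {J : ℕ → H →L[ℝ] H}

theorem eq_zero_of_smul_mem (hG : IsMaxDissipative G J) {f : H} {c : ℝ} (hc : 0 < c)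
    (h : (f, c • f) ∈ G) : f = 0 := by
  have := hG.dissipative _ _ h
  rw [real_inner_smul_right] at this
  have h0 : inner ℝ f f ≤ 0 := by
    by_contra! h'
    have := mul_pos hc h'
    linarith
  rw [real_inner_self_eq_norm_sq] at h0
  exact norm_eq_zero.1 (pow_eq_zero_iff two_ne_zero |>.1 (le_antisymm h0 (sq_nonneg _)))

/-- Uniqueness for the resolvent equation; the algebraic identities for `J` are all obtained by
checking that equation. -/
theorem eq_resolvent (hG : IsMaxDissipative G J) {n : ℕ} {u f : H}
    (h : (u, ((n : ℝ) + 1) • (u - f)) ∈ G) : u = J n f := by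
  have h1 := G.sub_mem h (hG.resolvent_mem n f)
  rw [Prod.mk_sub_mk, ← smul_sub, sub_sub_sub_cancel_right] at h1
  exact sub_eq_zero.1 (hG.eq_zero_of_smul_mem (by positivity) h1)

theorem norm_resolvent_le (hG : IsMaxDissipative G J) (n : ℕ) (f : H) : ‖J n f‖ ≤ ‖f‖ := by
  have h := hG.dissipative _ _ (hG.resolvent_mem n f)
  rw [real_inner_smul_right, inner_sub_right, real_inner_self_eq_norm_sq] at h
  have h1 : ‖J n f‖ ^ 2 - inner ℝ (J n f) f ≤ 0 := by
    by_contra! h'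
    have := mul_pos (show (0 : ℝ) < n + 1 by positivity) h'
    linarith
  have h2 := real_inner_le_norm (J n f) f
  by_contra! h3
  nlinarith [norm_nonneg f]

/-- The resolvent identity. Its right-hand side is symmetric in `n` and `m`, whence commutation. -/
theorem resolvent_comm_of_ne (hG : IsMaxDissipative G J) {n m : ℕ} (h : n ≠ m) (f : H) :
    J m (J n f) = ((n : ℝ) - m)⁻¹ • (((n : ℝ) + 1) • J m f - ((m : ℝ) + 1) • J n f) := by
  symm
  apply hG.eq_resolvent
  have hne : (n : ℝ) - m ≠ 0 := sub_ne_zero.2 (by exact_mod_cast h)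
  have h1 := G.smul_mem ((n : ℝ) - m)⁻¹ (G.sub_mem
    (G.smul_mem ((n : ℝ) + 1) (hG.resolvent_mem m f))
    (G.smul_mem ((m : ℝ) + 1) (hG.resolvent_mem n f)))
  convert h1 using 1
  simp only [Prod.smul_mk, Prod.mk_sub_mk]
  congr 1
  match_scalars <;> field_simp <;> ring

theorem commute_resolvent (hG : IsMaxDissipative G J) (n m : ℕ) : Commute (J n) (J m) := by
  rcases eq_or_ne n m with rfl | h
  · exact Commute.refl _
  · ext f
    rw [mul_apply_eq_comp, mul_apply_eq_comp,
      hG.resolvent_comm_of_ne h, hG.resolvent_comm_of_ne h.symm, ← neg_sub (n : ℝ) m, inv_neg,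
      neg_smul, ← smul_neg, neg_sub]

/-- On the domain the Yosida approximation is `J n L`, so it converges to `L` there. -/
theorem yosida_apply (hG : IsMaxDissipative G J) {f g : H} (h : (f, g) ∈ G) (n : ℕ) :
    ((n : ℝ) + 1) • (J n f - f) = J n g := by
  have h1 : f = J n (f - ((n : ℝ) + 1)⁻¹ • g) := by
    apply hG.eq_resolvent
    rwa [sub_sub_cancel, smul_inv_smul₀ (by positivity)]
  rw [map_sub, map_smul] at h1
  have h2 : J n f - f = ((n : ℝ) + 1)⁻¹ • J n g := by
    nth_rw 2 [h1]; abel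
  rw [h2, smul_inv_smul₀ (by positivity)]

/-- A vector of the domain close to a given one. -/
theorem exists_mem_norm_sub_lt (hG : IsMaxDissipative G J) (f : H) {ε : ℝ} (hε : 0 < ε) :
    ∃ f' g', (f', g') ∈ G ∧ ‖f - f'‖ < ε := by
  obtain ⟨n, hn⟩ := ((hG.tendsto_resolvent f).eventually (Metric.ball_mem_nhds f hε)).exists
  exact ⟨_, _, hG.resolvent_mem n f, by rwa [← dist_eq_norm, dist_comm]⟩

end IsMaxDissipative

/-- The semigroup generated by the Yosida approximation `(n + 1) (J n - 1)`. -/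
def yosidaSemigroup (J : ℕ → H →L[ℝ] H) (n : ℕ) (t : ℝ) : H →L[ℝ] H :=
  NormedSpace.exp (t • ((n : ℝ) + 1) • (J n - 1))

theorem yosidaSemigroup_mem [CompleteSpace H] {J : ℕ → H →L[ℝ] H} {C : Set H}
    (hC : IsClosed C) (hc : Convex ℝ C) (h0 : (0 : H) ∈ C) (hJ : ∀ n, Set.MapsTo (J n) C C)
    (n : ℕ) {t : ℝ} (ht : 0 ≤ t) {f : H} (hf : f ∈ C) : yosidaSemigroup J n t f ∈ C := by
  rw [yosidaSemigroup, smul_smul]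
  exact exp_smul_sub_one_mem hC hc h0 (hJ n) (by positivity) hf

theorem yosidaSemigroup_add [CompleteSpace H] (J : ℕ → H →L[ℝ] H) (n : ℕ) (s t : ℝ) :
    yosidaSemigroup J n (s + t) = yosidaSemigroup J n s * yosidaSemigroup J n t := by
  rw [yosidaSemigroup, add_smul, exp_add_clm]
  · rfl
  · exact ((Commute.refl _).smul_left _).smul_right _

namespace IsMaxDissipative

variable [CompleteSpace H] {G : Submodule ℝ (H × H)} {J : ℕ → H →L[ℝ] H}

theorem norm_yosidaSemigroup_le (hG : IsMaxDissipative G J) (n : ℕ) {t : ℝ} (ht : 0 ≤ t) (f : H) :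
    ‖yosidaSemigroup J n t f‖ ≤ ‖f‖ := by
  -- Contractivity is invariance of a closed ball, a convex set containing `0`.
  have := yosidaSemigroup_mem (J := J) (C := Metric.closedBall 0 ‖f‖) Metric.isClosed_closedBall
    (convex_closedBall _ _) (by simp) (fun n g hg => by
      rw [mem_closedBall_zero_iff] at hg ⊢
      exact (hG.norm_resolvent_le n g).trans hg) n ht (f := f) (by simp)
  simpa using this

theorem norm_yosidaSemigroup_sub_le (hG : IsMaxDissipative G J) (n m : ℕ) {t : ℝ} (ht : 0 ≤ t)
    {f g : H} (h : (f, g) ∈ G) :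
    ‖yosidaSemigroup J n t f - yosidaSemigroup J m t f‖ ≤ t * ‖J n g - J m g‖ := by
  rw [← hG.yosida_apply h n, ← hG.yosida_apply h m]
  refine norm_exp_smul_sub_exp_smul_le (A := ((n : ℝ) + 1) • (J n - 1))
    (B := ((m : ℝ) + 1) • (J m - 1)) ?_ ?_ ?_ ht f
  · refine (Commute.smul_left ?_ _).smul_right _
    exact ((hG.commute_resolvent n m).sub_left (Commute.one_left _)).sub_right
      (Commute.one_right _)
  · exact fun s hs f => hG.norm_yosidaSemigroup_le n hs f
  · exact fun s hs f => hG.norm_yosidaSemigroup_le m hs f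

theorem norm_yosidaSemigroup_sub_self_le (hG : IsMaxDissipative G J) (n : ℕ) {t : ℝ} (ht : 0 ≤ t)
    {f g : H} (h : (f, g) ∈ G) : ‖yosidaSemigroup J n t f - f‖ ≤ t * ‖g‖ := by
  have := norm_exp_smul_sub_exp_smul_le (A := ((n : ℝ) + 1) • (J n - 1)) (B := 0)
    (Commute.zero_right _) (fun s hs f => hG.norm_yosidaSemigroup_le n hs f)
    (by simp [NormedSpace.exp_zero]) ht f
  have h2 : (((n : ℝ) + 1) • (J n - 1)) f = J n g := hG.yosida_apply h n
  rw [h2] at this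
  simp only [smul_zero, NormedSpace.exp_zero, one_apply_eq_self, zero_apply, sub_zero] at this
  exact this.trans (mul_le_mul_of_nonneg_left (hG.norm_resolvent_le n g) ht)

theorem cauchySeq_yosidaSemigroup (hG : IsMaxDissipative G J) {t : ℝ} (ht : 0 ≤ t) (f : H) :
    CauchySeq fun n => yosidaSemigroup J n t f := by
  rw [Metric.cauchySeq_iff]
  intro ε hε
  obtain ⟨f', g', hfg, hf'⟩ := hG.exists_mem_norm_sub_lt f (show 0 < ε / 4 by positivity)
  obtain ⟨N, hN⟩ := Metric.cauchySeq_iff.1 (hG.tendsto_resolvent g').cauchySeq (ε / (2 * (t + 1)))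
    (by positivity)
  refine ⟨N, fun m hm n hn => ?_⟩
  rw [dist_eq_norm]
  have e : yosidaSemigroup J m t f - yosidaSemigroup J n t f =
      yosidaSemigroup J m t (f - f') - yosidaSemigroup J n t (f - f') +
      (yosidaSemigroup J m t f' - yosidaSemigroup J n t f') := by
    simp only [map_sub]; abel
  have h1 := hG.norm_yosidaSemigroup_le m ht (f - f')
  have h2 := hG.norm_yosidaSemigroup_le n ht (f - f')
  have h3 := hG.norm_yosidaSemigroup_sub_le m n ht hfg
  have h4 := hN m hm n hn
  rw [dist_eq_norm] at h4
  have h5 : t * ‖J m g' - J n g'‖ ≤ ε / 2 := by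
    calc t * ‖J m g' - J n g'‖ ≤ (t + 1) * (ε / (2 * (t + 1))) := by gcongr; linarith
      _ = ε / 2 := by field_simp
  rw [e]
  have h6 := norm_add_le (yosidaSemigroup J m t (f - f') - yosidaSemigroup J n t (f - f'))
    (yosidaSemigroup J m t f' - yosidaSemigroup J n t f')
  have h7 := norm_sub_le (yosidaSemigroup J m t (f - f')) (yosidaSemigroup J n t (f - f'))
  linarith

end IsMaxDissipative

/-- The limit of the Yosida semigroups. -/
theorem exists_limit_yosidaSemigroup [CompleteSpace H] {G : Submodule ℝ (H × H)}
    {J : ℕ → H →L[ℝ] H} (hG : IsMaxDissipative G J) :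
    ∃ P : ℝ≥0 → H →L[ℝ] H,
      ∀ (t : ℝ≥0) f, Tendsto (fun n => yosidaSemigroup J n t f) atTop (𝓝 (P t f)) := by
  choose P hP using fun (t : ℝ≥0) f =>
    cauchySeq_tendsto_of_complete (hG.cauchySeq_yosidaSemigroup t.2 f)
  have hlin : ∀ t : ℝ≥0, ∃ T : H →L[ℝ] H, ∀ f, T f = P t f := fun t =>
    ⟨(linearMapOfTendsto (P t) (fun n => (yosidaSemigroup J n t : H →ₗ[ℝ] H))
      (tendsto_pi_nhds.2 (hP t))).mkContinuous 1 fun f => by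
        rw [one_mul]
        exact le_of_tendsto (hP t f).norm
          (Eventually.of_forall fun n => hG.norm_yosidaSemigroup_le n t.2 f), fun f => rfl⟩
  choose T hT using hlin
  exact ⟨T, fun t f => by rw [hT]; exact hP t f⟩

namespace IsMaxDissipative

variable [CompleteSpace H] {G : Submodule ℝ (H × H)} {J : ℕ → H →L[ℝ] H}

/-- The Hille-Yosida theorem for dissipative operators on a Hilbert space. -/
theorem exists_isSemigroupOf (hG : IsMaxDissipative G J) :
    ∃ P : ℝ≥0 → H →L[ℝ] H, IsSemigroupOf G P ∧
      ∀ C : Set H, IsClosed C → Convex ℝ C → (0 : H) ∈ C → (∀ n, Set.MapsTo (J n) C C) →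
        ∀ t, Set.MapsTo (P t) C C := by
  obtain ⟨P, hP⟩ := exists_limit_yosidaSemigroup hG
  have hinv : ∀ C : Set H, IsClosed C → Convex ℝ C → (0 : H) ∈ C →
      (∀ n, Set.MapsTo (J n) C C) → ∀ t, Set.MapsTo (P t) C C := fun C h1 h2 h3 h4 t f hf =>
    h1.mem_of_tendsto (hP t f) (Eventually.of_forall fun n =>
      yosidaSemigroup_mem h1 h2 h3 h4 n t.2 hf)
  have hnorm : ∀ t f, ‖P t f‖ ≤ ‖f‖ := fun t f => le_of_tendsto (hP t f).norm
    (Eventually.of_forall fun n => hG.norm_yosidaSemigroup_le n t.2 f)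
  have hzero : P 0 = ContinuousLinearMap.id ℝ H := by
    ext f
    refine tendsto_nhds_unique (hP 0 f) ?_
    simp [yosidaSemigroup, NormedSpace.exp_zero]
  have hadd : ∀ s t : ℝ≥0, P (s + t) = (P s).comp (P t) := by
    intro s t
    ext f
    refine tendsto_nhds_unique (hP (s + t) f) ?_
    have h1 : Tendsto (fun n => yosidaSemigroup J n s (yosidaSemigroup J n t f - P t f)) atTop
        (𝓝 0) := by
      refine squeeze_zero_norm (fun n => hG.norm_yosidaSemigroup_le n s.2 _) ?_
      simpa using ((hP t f).sub_const (P t f)).norm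
    have h2 := h1.add (hP s (P t f))
    simp only [zero_add] at h2
    refine h2.congr fun n => ?_
    rw [map_sub, sub_add_cancel, NNReal.coe_add, yosidaSemigroup_add, mul_apply_eq_comp]
  have hself : ∀ (t : ℝ≥0) f g, (f, g) ∈ G → ‖P t f - f‖ ≤ t * ‖g‖ := fun t f g hfg =>
    le_of_tendsto ((hP t f).sub_const f).norm
      (Eventually.of_forall fun n => hG.norm_yosidaSemigroup_sub_self_le n t.2 hfg)
  have hlip : ∀ (s t : ℝ≥0) f g, (f, g) ∈ G → s ≤ t → ‖P t f - P s f‖ ≤ (t - s) * ‖g‖ := by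
    intro s t f g hfg hst
    have h1 : t = s + (t - s) := (add_tsub_cancel_of_le hst).symm
    have h2 : P t f - P s f = P s (P (t - s) f - f) := by
      conv_lhs => rw [h1, hadd]
      simp
    rw [h2]
    refine (hnorm _ _).trans ((hself _ f g hfg).trans_eq ?_)
    rw [NNReal.coe_sub hst]
  have hcontG : ∀ f g, (f, g) ∈ G → Continuous fun t : ℝ≥0 => P t f := by
    intro f g hfg
    refine (LipschitzWith.of_dist_le_mul (K := ‖g‖₊) fun s t => ?_).continuous
    rw [dist_eq_norm, NNReal.dist_eq, coe_nnnorm, mul_comm]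
    rcases le_total s t with h | h
    · rw [norm_sub_rev, abs_sub_comm, abs_of_nonneg (sub_nonneg.2 (NNReal.coe_le_coe.2 h))]
      exact hlip s t f g hfg h
    · rw [abs_of_nonneg (sub_nonneg.2 (NNReal.coe_le_coe.2 h))]
      exact hlip t s f g hfg h
  have hcont : ∀ f : H, Continuous fun t : ℝ≥0 => P t f := by
    intro f
    -- Orbits of domain vectors are Lipschitz, and every orbit is a uniform limit of such ones.
    have hu : TendstoUniformly (fun n (t : ℝ≥0) => P t (J n f)) (fun t => P t f) atTop := by
      rw [Metric.tendstoUniformly_iff]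
      intro ε hε
      filter_upwards [(hG.tendsto_resolvent f).eventually (Metric.ball_mem_nhds f hε)] with n hn t
      rw [dist_eq_norm, ← map_sub]
      refine (hnorm _ _).trans_lt ?_
      rwa [← dist_eq_norm, dist_comm]
    exact hu.continuous (Frequently.of_forall fun n => hcontG _ _ (hG.resolvent_mem n f))
  have hforward : ∀ f g, (f, g) ∈ G →
      Tendsto (fun t : ℝ≥0 => (t : ℝ)⁻¹ • (P t f - f)) (𝓝[>] 0) (𝓝 g) := by
    intro f g hfg
    -- The remainder is the integral of `P s g - g` over `[0, t]`. As `g` need not be in the domain,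
    -- it is compared with a domain vector `f'`, whose orbit moves at speed at most `‖g'‖`. The
    -- estimate is made for the Yosida semigroups and passed to the limit.
    have hest : ∀ (t : ℝ≥0) f' g', (f', g') ∈ G →
        ‖P t f - f - (t : ℝ) • g‖ ≤ t * (2 * ‖g - f'‖ + t * ‖g'‖) := by
      intro t f' g' hfg'
      have hn : ∀ n, ‖yosidaSemigroup J n t f - f - (t : ℝ) • J n g‖ ≤
          t * (2 * ‖J n g - g‖ + 2 * ‖g - f'‖ + t * ‖g'‖) := by
        intro n
        set A : H →L[ℝ] H := ((n : ℝ) + 1) • (J n - 1)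
        have hA : A f = J n g := hG.yosida_apply hfg n
        have hd : ∀ s ∈ Set.Icc (0 : ℝ) t, HasDerivWithinAt
            (fun s : ℝ => yosidaSemigroup J n s f - s • J n g)
            (yosidaSemigroup J n s (J n g) - J n g) (Set.Icc (0 : ℝ) t) s := by
          intro s _
          have h1 := (ContinuousLinearMap.apply ℝ H f).hasFDerivAt.comp_hasDerivAt s
            (hasDerivAt_exp_smul_const (𝕂 := ℝ) A s)
          have h2 := h1.sub ((hasDerivAt_id s).smul_const (J n g))
          rw [one_smul, ← hA] at h2
          rw [← hA]
          exact h2.hasDerivWithinAt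
        have hb : ∀ s ∈ Set.Ico (0 : ℝ) t, ‖yosidaSemigroup J n s (J n g) - J n g‖ ≤
            2 * ‖J n g - g‖ + 2 * ‖g - f'‖ + t * ‖g'‖ := by
          intro s hs
          have e : yosidaSemigroup J n s (J n g) - J n g =
              (yosidaSemigroup J n s (J n g - f') - (J n g - f')) +
              (yosidaSemigroup J n s f' - f') := by
            simp only [map_sub]; abel
          have h1 := hG.norm_yosidaSemigroup_le n hs.1 (J n g - f')
          have h2 := hG.norm_yosidaSemigroup_sub_self_le n hs.1 hfg'
          have h3 := norm_sub_le (yosidaSemigroup J n s (J n g - f')) (J n g - f')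
          have h4 := norm_add_le (yosidaSemigroup J n s (J n g - f') - (J n g - f'))
            (yosidaSemigroup J n s f' - f')
          have h5 : s * ‖g'‖ ≤ t * ‖g'‖ := mul_le_mul_of_nonneg_right hs.2.le (norm_nonneg _)
          have h6 : ‖J n g - f'‖ ≤ ‖J n g - g‖ + ‖g - f'‖ := norm_sub_le_norm_sub_add_norm_sub _ _ _
          rw [e]
          linarith
        have := norm_image_sub_le_of_norm_deriv_le_segment' hd hb t ⟨t.2, le_rfl⟩
        have h0 : yosidaSemigroup J n 0 f = f := by simp [yosidaSemigroup, NormedSpace.exp_zero]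
        rw [h0, zero_smul, sub_zero, sub_zero, mul_comm, sub_right_comm] at this
        exact this
      have hl : Tendsto (fun n => ‖yosidaSemigroup J n t f - f - (t : ℝ) • J n g‖) atTop
          (𝓝 ‖P t f - f - (t : ℝ) • g‖) :=
        (((hP t f).sub_const f).sub ((hG.tendsto_resolvent g).const_smul (t : ℝ))).norm
      have hr : Tendsto (fun n => (t : ℝ) * (2 * ‖J n g - g‖ + 2 * ‖g - f'‖ + t * ‖g'‖)) atTop
          (𝓝 (t * (2 * ‖g - g‖ + 2 * ‖g - f'‖ + t * ‖g'‖))) :=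
        ((((((hG.tendsto_resolvent g).sub_const g).norm).const_mul 2).add_const _).add_const
          _).const_mul _
      rw [sub_self, norm_zero, mul_zero, zero_add] at hr
      exact le_of_tendsto_of_tendsto' hl hr hn
    rw [Metric.tendsto_nhds]
    intro ε hε
    obtain ⟨f', g', hfg', hf'⟩ := hG.exists_mem_norm_sub_lt g (show 0 < ε / 4 by positivity)
    have h1 : Tendsto (fun t : ℝ≥0 => (t : ℝ) * ‖g'‖) (𝓝[>] 0) (𝓝 (((0 : ℝ≥0) : ℝ) * ‖g'‖)) :=
      (Continuous.tendsto (by fun_prop) 0).mono_left nhdsWithin_le_nhds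
    rw [NNReal.coe_zero, zero_mul] at h1
    filter_upwards [h1.eventually (gt_mem_nhds (show 0 < ε / 2 by positivity)),
      self_mem_nhdsWithin] with t ht ht0
    have ht0' : (0 : ℝ) < t := ht0
    have e : (t : ℝ)⁻¹ • (P t f - f) - g = (t : ℝ)⁻¹ • (P t f - f - (t : ℝ) • g) := by
      rw [smul_sub _ _ ((t : ℝ) • g), inv_smul_smul₀ ht0'.ne']
    rw [dist_eq_norm, e, norm_smul, norm_inv, Real.norm_of_nonneg ht0'.le, inv_mul_lt_iff₀ ht0']
    refine (hest t f' g' hfg').trans_lt ?_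
    gcongr
    linarith
  refine ⟨P, ⟨hzero, hadd, hcont, fun f g => ⟨fun h => ?_, hforward f g⟩⟩, hinv⟩
  -- The generator of `P` has no larger domain. Index `0` is the resolvent at `1`, so `f' - L f' = f
  -- - g`; then `f - f'` has right derivative `f - f'` at time zero, which for a contraction
  -- semigroup forces `f = f'`.
  have hmem := hG.resolvent_mem 0 (f - g)
  set f' := J 0 (f - g) with hf'
  simp only [Nat.cast_zero, zero_add, one_smul] at hmem
  have hd := h.sub (hforward _ _ hmem)
  have hlim : g - (f' - (f - g)) = f - f' := by abel
  rw [hlim] at hd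
  have hle : inner ℝ (f - f') (f - f') ≤ 0 := by
    refine le_of_tendsto (hd.inner tendsto_const_nhds) ?_
    filter_upwards [self_mem_nhdsWithin] with t ht
    have ht' : (0 : ℝ) < t := ht
    rw [← smul_sub, real_inner_smul_left]
    have e : P t f - f - (P t f' - f') = P t (f - f') - (f - f') := by
      rw [map_sub]; abel
    rw [e, inner_sub_left, real_inner_self_eq_norm_sq]
    have h1 := real_inner_le_norm (P t (f - f')) (f - f')
    have h2 := mul_le_mul_of_nonneg_right (hnorm t (f - f')) (norm_nonneg (f - f'))
    have h3 : inner ℝ (P t (f - f')) (f - f') - ‖f - f'‖ ^ 2 ≤ 0 := by nlinarith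
    exact mul_nonpos_of_nonneg_of_nonpos (by positivity) h3
  rw [real_inner_self_eq_norm_sq] at hle
  have heq : f = f' := sub_eq_zero.1
    (norm_eq_zero.1 ((pow_eq_zero_iff two_ne_zero).1 (le_antisymm hle (sq_nonneg _))))
  have hg : f' - (f - g) = g := by rw [← heq]; abel
  rw [hg, ← heq] at hmem
  exact hmem

end IsMaxDissipative
end HilleYosida

/-! ### Orbits of a semigroup: uniqueness and decay -/

namespace IsSemigroupOf

variable {H : Type*} [NormedAddCommGroup H] [InnerProductSpace ℝ H]
  {G : Submodule ℝ (H × H)} {P Q : ℝ≥0 → H →L[ℝ] H}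

theorem apply_mem (hP : IsSemigroupOf G P) {f g : H} (h : (f, g) ∈ G) (t : ℝ≥0) :
    (P t f, P t g) ∈ G := by
  rw [← hP.generator]
  refine (((P t).continuous.tendsto g).comp ((hP.generator f g).2 h)).congr fun s => ?_
  have : P s (P t f) = P t (P s f) := by
    have h1 := congrArg (fun T : H →L[ℝ] H => T f) (hP.map_add s t)
    have h2 := congrArg (fun T : H →L[ℝ] H => T f) (hP.map_add t s)
    rw [add_comm] at h2
    exact h1.symm.trans h2
  simp [this]

theorem hasDerivWithinAt (hP : IsSemigroupOf G P) {f g : H} (h : (f, g) ∈ G) {t : ℝ}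
    (ht : 0 ≤ t) : HasDerivWithinAt (fun s : ℝ => P s.toNNReal f) (P t.toNNReal g) (Set.Ici t) t := by
  rw [hasDerivWithinAt_iff_tendsto_slope]
  have h1 := (hP.generator _ _).2 (hP.apply_mem h t.toNNReal)
  have h2 : Tendsto (fun s : ℝ => (s - t).toNNReal) (𝓝[Set.Ici t \ {t}] t) (𝓝[>] 0) := by
    refine tendsto_nhdsWithin_iff.2 ⟨?_, ?_⟩
    · have : Continuous fun s : ℝ => (s - t).toNNReal := by fun_prop
      have := this.tendsto t
      rw [sub_self, Real.toNNReal_zero] at this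
      exact this.mono_left nhdsWithin_le_nhds
    · filter_upwards [self_mem_nhdsWithin] with s hs
      have : t < s := lt_of_le_of_ne hs.1 (Ne.symm hs.2)
      simpa using this
  refine (h1.comp h2).congr' ?_
  filter_upwards [self_mem_nhdsWithin] with s hs
  have hts : t ≤ s := hs.1
  have h3 : s.toNNReal = (s - t).toNNReal + t.toNNReal := by
    rw [← Real.toNNReal_add (sub_nonneg.2 hts) ht, sub_add_cancel]
  simp only [Function.comp_apply, slope, vsub_eq_sub]
  rw [h3, hP.map_add, Real.coe_toNNReal _ (sub_nonneg.2 hts)]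
  rfl

theorem continuous_real (hP : IsSemigroupOf G P) (f : H) :
    Continuous fun s : ℝ => P s.toNNReal f :=
  (hP.strong_continuous f).comp continuous_real_toNNReal

/-- For `f` in the domain, dissipativity makes the squared distance of the two orbits nonincreasing,
and it starts at zero. The vectors `J n f` extend this to all `f`. -/
theorem eq_of_isMaxDissipative {J : ℕ → H →L[ℝ] H} (hG : IsMaxDissipative G J)
    (hP : IsSemigroupOf G P) (hQ : IsSemigroupOf G Q) : Q = P := by
  have key : ∀ f g, (f, g) ∈ G → ∀ t, Q t f = P t f := by
    intro f g h t
    have hd : ∀ s ∈ Set.Ico (0 : ℝ) t, HasDerivWithinAt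
        (fun s : ℝ => ‖Q s.toNNReal f - P s.toNNReal f‖ ^ 2)
        (2 * inner ℝ (Q s.toNNReal f - P s.toNNReal f) (Q s.toNNReal g - P s.toNNReal g))
        (Set.Ici s) s := fun s hs =>
      ((hQ.hasDerivWithinAt h hs.1).sub (hP.hasDerivWithinAt h hs.1)).norm_sq
    have hle := image_le_of_deriv_right_le_deriv_boundary (a := 0) (b := t)
      (((hQ.continuous_real f).sub (hP.continuous_real f)).norm.pow 2).continuousOn hd
      (B := fun _ => 0) (B' := fun _ => 0) (by simp [hQ.map_zero, hP.map_zero])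
      continuousOn_const (fun s _ => hasDerivWithinAt_const ..) (fun s hs => by
        have := hG.dissipative _ _ (G.sub_mem (hQ.apply_mem h s.toNNReal)
          (hP.apply_mem h s.toNNReal))
        linarith) (x := t) ⟨t.2, le_rfl⟩
    change ‖Q (t : ℝ).toNNReal f - P (t : ℝ).toNNReal f‖ ^ 2 ≤ 0 at hle
    rw [Real.toNNReal_coe] at hle
    exact sub_eq_zero.1
      (norm_eq_zero.1 ((pow_eq_zero_iff two_ne_zero).1 (le_antisymm hle (sq_nonneg _))))
  ext t f
  have h1 := (((Q t).continuous.tendsto f).comp (hG.tendsto_resolvent f))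
  have h2 := (((P t).continuous.tendsto f).comp (hG.tendsto_resolvent f))
  refine tendsto_nhds_unique h1 (h2.congr fun n => ?_)
  exact (key _ _ (hG.resolvent_mem n f) t).symm

theorem apply_eq_self (hP : IsSemigroupOf G P) {f : H} (h : (f, 0) ∈ G) (t : ℝ≥0) :
    P t f = f := by
  have := constant_of_has_deriv_right_zero (a := 0) (b := t) (hP.continuous_real f).continuousOn
    (fun s hs => by simpa using hP.hasDerivWithinAt h hs.1) t ⟨t.2, le_rfl⟩
  simpa [hP.map_zero] using this

/-- Exponential decay up to an additive error under an inequality of weak Poincaré type along the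
orbit. -/
theorem norm_sq_le_of_weakPoincare (hP : IsSemigroupOf G P) {f g : H} (h : (f, g) ∈ G)
    {β b : ℝ} (hβ : 0 < β) (hb : 0 ≤ b)
    (hW : ∀ t, ‖P t f‖ ^ 2 ≤ -(β * inner ℝ (P t f) (P t g)) + b) (t : ℝ≥0) :
    ‖P t f‖ ^ 2 ≤ Real.exp (-(2 * t / β)) * ‖f‖ ^ 2 + b := by
  -- Gronwall with integrating factor `e^(2s/β)`: `hW` says exactly that this function has
  -- nonpositive right derivative.
  have hd : ∀ s ∈ Set.Ico (0 : ℝ) t, HasDerivWithinAt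
      (fun s : ℝ => Real.exp (2 * s / β) * (‖P s.toNNReal f‖ ^ 2 - b))
      (Real.exp (2 * s / β) * (2 / β) * (‖P s.toNNReal f‖ ^ 2 - b) +
        Real.exp (2 * s / β) * (2 * inner ℝ (P s.toNNReal f) (P s.toNNReal g)))
      (Set.Ici s) s := by
    intro s hs
    have h1 : HasDerivAt (fun s : ℝ => Real.exp (2 * s / β)) (Real.exp (2 * s / β) * (2 / β)) s := by
      have := (((hasDerivAt_id s).const_mul 2).div_const β).exp
      simpa using this
    exact h1.hasDerivWithinAt.mul (((hP.hasDerivWithinAt h hs.1).norm_sq).sub_const b)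
  have hc : Continuous fun s : ℝ => Real.exp (2 * s / β) * (‖P s.toNNReal f‖ ^ 2 - b) := by
    have h1 : Continuous fun s : ℝ => Real.exp (2 * s / β) := by fun_prop
    exact h1.mul (((hP.continuous_real f).norm.pow 2).sub continuous_const)
  have hle := image_le_of_deriv_right_le_deriv_boundary (a := 0) (b := t)
    hc.continuousOn hd (B := fun _ => ‖f‖ ^ 2 - b) (B' := fun _ => 0) (by simp [hP.map_zero])
    continuousOn_const (fun s _ => hasDerivWithinAt_const ..) (fun s hs => by
      have h1 := hW s.toNNReal
      have h2 : 2 / β * (‖P s.toNNReal f‖ ^ 2 - b) +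
          2 * inner ℝ (P s.toNNReal f) (P s.toNNReal g) ≤ 0 := by
        have h3 : (2 / β) * (β * inner ℝ (P s.toNNReal f) (P s.toNNReal g)) =
          2 * inner ℝ (P s.toNNReal f) (P s.toNNReal g) := by field_simp
        rw [← h3, ← mul_add]
        exact mul_nonpos_of_nonneg_of_nonpos (by positivity) (by linarith)
      rw [mul_assoc, ← mul_add]
      exact mul_nonpos_of_nonneg_of_nonpos (Real.exp_pos _).le h2) (x := t) ⟨t.2, le_rfl⟩
  simp only [Real.toNNReal_coe] at hle
  have h1 : ‖P t f‖ ^ 2 - b = Real.exp (-(2 * t / β)) *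
      (Real.exp (2 * t / β) * (‖P t f‖ ^ 2 - b)) := by
    rw [← mul_assoc, ← Real.exp_add]; simp
  have h2 := mul_le_mul_of_nonneg_left hle (Real.exp_pos (-(2 * t / β))).le
  rw [← h1] at h2
  nlinarith [Real.exp_pos (-(2 * t / β))]

end IsSemigroupOf

/-! ### From a closed form to its generator -/

section ClosedForm

variable {H K : Type*} [NormedAddCommGroup H] [InnerProductSpace ℝ H]
  [NormedAddCommGroup K] [InnerProductSpace ℝ K]

/-- The graph of the operator `L = -T* T`, where `Γ` is the graph of `T`. -/
def formOperator (Γ : Submodule ℝ (H × K)) : Submodule ℝ (H × H) where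
  carrier := {p | ∃ k, (p.1, k) ∈ Γ ∧ ∀ h l, (h, l) ∈ Γ → inner ℝ k l = -inner ℝ p.2 h}
  zero_mem' := ⟨0, Γ.zero_mem, by simp⟩
  add_mem' := by
    rintro p q ⟨k, hk, hp⟩ ⟨k', hk', hq⟩
    refine ⟨k + k', Γ.add_mem hk hk', fun h l hl => ?_⟩
    rw [inner_add_left, hp h l hl, hq h l hl, Prod.snd_add, inner_add_left, neg_add]
  smul_mem' := by
    rintro c p ⟨k, hk, hp⟩
    refine ⟨c • k, Γ.smul_mem c hk, fun h l hl => ?_⟩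
    rw [real_inner_smul_left, hp h l hl, Prod.smul_snd, real_inner_smul_left, mul_neg]

theorem mem_formOperator {Γ : Submodule ℝ (H × K)} {f g : H} : (f, g) ∈ formOperator Γ ↔
    ∃ k, (f, k) ∈ Γ ∧ ∀ h l, (h, l) ∈ Γ → inner ℝ k l = -inner ℝ g h := Iff.rfl

/-- The graph of the operator `T / c`, in the Hilbert sum of `H` and `K`. -/
def scaledGraph (Γ : Submodule ℝ (H × K)) (c : ℝ) : Submodule ℝ (WithLp 2 (H × K)) :=
  Γ.comap ((LinearMap.id.prodMap (c • LinearMap.id)) ∘ₗ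
    (WithLp.linearEquiv 2 ℝ (H × K)).toLinearMap)

theorem mem_scaledGraph {Γ : Submodule ℝ (H × K)} {c : ℝ} {p : WithLp 2 (H × K)} :
    p ∈ scaledGraph Γ c ↔ (p.fst, c • p.snd) ∈ Γ := Iff.rfl

/-- Testing the resolvent equation with `u - f` is possible when `f` lies in the form domain; this
gives strong convergence of resolvents as `c → ∞`. -/
theorem norm_sub_sq_le_of_resolvent {Γ : Submodule ℝ (H × K)} {c : ℝ} (hc : 0 < c)
    {f u : H} {k l : K} (hu : (u, k) ∈ Γ)
    (h : ∀ h l, (h, l) ∈ Γ → inner ℝ k l = -inner ℝ (c • (u - f)) h) (hf : (f, l) ∈ Γ) :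
    ‖u - f‖ ^ 2 ≤ ‖l‖ ^ 2 / c := by
  have h1 := h _ _ (Γ.sub_mem hu hf)
  rw [real_inner_smul_left, real_inner_self_eq_norm_sq, inner_sub_right,
    real_inner_self_eq_norm_sq] at h1
  have h2 := real_inner_le_norm k l
  rw [le_div_iff₀ hc]
  nlinarith [sq_nonneg (‖k‖ - ‖l‖), sq_nonneg ‖k‖, sq_nonneg ‖l‖]

variable [CompleteSpace H] [CompleteSpace K]

/-- Project `(f, 0)` orthogonally onto the graph of `T / c`, that is, minimize `‖u - f‖² + ‖T u‖² /
c²`. The orthogonality relation is the weak resolvent equation at `c²`, and projections are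
contractions. -/
theorem exists_formResolvent {Γ : Submodule ℝ (H × K)} (hΓ : IsClosed (Γ : Set (H × K)))
    {c : ℝ} (hc : 0 < c) : ∃ J : H →L[ℝ] H, (∀ f, ‖J f‖ ≤ ‖f‖) ∧
      ∀ f, ∃ k, (J f, k) ∈ Γ ∧
        ∀ h l, (h, l) ∈ Γ → inner ℝ k l = -inner ℝ (c ^ 2 • (J f - f)) h := by
  have hcl : IsClosed (scaledGraph Γ c : Set (WithLp 2 (H × K))) :=
    hΓ.preimage (((ContinuousLinearMap.id ℝ H).prodMap (c • ContinuousLinearMap.id ℝ K)) ∘L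
      (WithLp.prodContinuousLinearEquiv 2 ℝ H K : WithLp 2 (H × K) →L[ℝ] H × K)).continuous
  have : CompleteSpace (scaledGraph Γ c) := hcl.completeSpace_coe
  let ι : H →L[ℝ] WithLp 2 (H × K) :=
    ((WithLp.prodContinuousLinearEquiv 2 ℝ H K).symm : H × K →L[ℝ] WithLp 2 (H × K)) ∘L
      ContinuousLinearMap.inl ℝ H K
  let π : WithLp 2 (H × K) →L[ℝ] H := ContinuousLinearMap.fst ℝ H K ∘L
    (WithLp.prodContinuousLinearEquiv 2 ℝ H K : WithLp 2 (H × K) →L[ℝ] H × K)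
  have hι : ∀ f, ι f = WithLp.toLp 2 (f, 0) := fun f => rfl
  have hπ : ∀ p, π p = p.fst := fun p => rfl
  refine ⟨π ∘L (scaledGraph Γ c).starProjection ∘L ι, fun f => ?_, fun f => ?_⟩
  · simp only [ContinuousLinearMap.comp_apply, hπ]
    refine (WithLp.norm_fst_le _ _).trans
      (((scaledGraph Γ c).norm_starProjection_apply_le _).trans ?_)
    rw [hι, WithLp.norm_toLp_fst]
  · simp only [ContinuousLinearMap.comp_apply, hπ]
    set p := (scaledGraph Γ c).starProjection (ι f) with hp
    have hpm : p ∈ scaledGraph Γ c := Submodule.starProjection_apply_mem _ _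
    refine ⟨c • p.snd, mem_scaledGraph.1 hpm, fun h l hl => ?_⟩
    have h1 := (scaledGraph Γ c).starProjection_inner_eq_zero (ι f) (WithLp.toLp 2 (h, c⁻¹ • l))
      (mem_scaledGraph.2 (by simpa [smul_smul, hc.ne'] using hl))
    rw [← hp, WithLp.prod_inner_apply] at h1
    simp only [hι, WithLp.ofLp_sub, Prod.fst_sub, Prod.snd_sub, real_inner_smul_right,
      zero_sub, inner_neg_left] at h1
    have h2 : inner ℝ p.ofLp.2 l = c * inner ℝ (f - p.ofLp.1) h := by
      field_simp at h1
      linarith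
    rw [real_inner_smul_left, real_inner_smul_left, ← neg_sub f, inner_neg_left]
    change c * inner ℝ p.ofLp.2 l = -(c ^ 2 * -inner ℝ (f - p.ofLp.1) h)
    rw [h2]; ring

/-- A densely defined closed form generates a maximal dissipative operator. -/
theorem exists_isMaxDissipative_formOperator {Γ : Submodule ℝ (H × K)}
    (hΓ : IsClosed (Γ : Set (H × K)))
    (hd : ∀ f : H, ∀ ε : ℝ, 0 < ε → ∃ h l, (h, l) ∈ Γ ∧ ‖f - h‖ < ε) :
    ∃ J : ℕ → H →L[ℝ] H, IsMaxDissipative (formOperator Γ) J := by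
  -- The scale is `c = √(n + 1)`, so that `c²` is the resolvent parameter `n + 1`.
  choose J hJ1 hJ2 using fun n : ℕ =>
    exists_formResolvent hΓ (Real.sqrt_pos.2 (show (0 : ℝ) < n + 1 by positivity))
  have hJ3 : ∀ n f, ∃ k, (J n f, k) ∈ Γ ∧
      ∀ h l, (h, l) ∈ Γ → inner ℝ k l = -inner ℝ (((n : ℝ) + 1) • (J n f - f)) h := by
    intro n f
    have := hJ2 n f
    rwa [Real.sq_sqrt (by positivity)] at this
  refine ⟨J, ⟨?_, hJ3, ?_⟩⟩
  · rintro f g ⟨k, hk, hg⟩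
    have := hg f k hk
    rw [real_inner_self_eq_norm_sq] at this
    rw [real_inner_comm]
    nlinarith [sq_nonneg ‖k‖]
  · intro f
    rw [Metric.tendsto_nhds]
    intro ε hε
    obtain ⟨h, l, hl, hfh⟩ := hd f (ε / 3) (by positivity)
    have h1 : Tendsto (fun n : ℕ => ‖l‖ ^ 2 * ((n : ℝ) + 1)⁻¹) atTop (𝓝 (‖l‖ ^ 2 * 0)) :=
      (tendsto_inv_atTop_zero.comp
        (tendsto_atTop_add_const_right _ 1 tendsto_natCast_atTop_atTop)).const_mul _
    rw [mul_zero] at h1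
    filter_upwards [h1.eventually (gt_mem_nhds (show 0 < (ε / 3) ^ 2 by positivity))] with n hn
    obtain ⟨k, hk, hk'⟩ := hJ3 n h
    have h2 := norm_sub_sq_le_of_resolvent (by positivity) hk hk' hl
    have h3 : ‖J n h - h‖ < ε / 3 := by
      refine lt_of_pow_lt_pow_left₀ 2 (by positivity) (h2.trans_lt ?_)
      rwa [div_eq_mul_inv]
    rw [dist_eq_norm]
    have e : J n f - f = J n (f - h) + (J n h - h) + -(f - h) := by rw [map_sub]; abel
    rw [e]
    have h4 := norm_add₃_le (a := J n (f - h)) (b := J n h - h) (c := -(f - h))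
    rw [norm_neg] at h4
    have h5 := hJ1 n (f - h)
    linarith

end ClosedForm

/-! ### The energy as the squared norm of a closed increment operator -/

section
variable {d : ℕ} {α : ℝ} {V : EuclideanSpace ℝ (Fin d) → ℝ}

/-- The measure `μ_V(dx) dy`. -/
abbrev prodMeasure (V : EuclideanSpace ℝ (Fin d) → ℝ) :
    Measure (EuclideanSpace ℝ (Fin d) × EuclideanSpace ℝ (Fin d)) := (mu V).prod volume

theorem lintegral_exp_ne_top [IsProbabilityMeasure (mu V)] :
    ∫⁻ x, ENNReal.ofReal (Real.exp (-V x)) ≠ ∞ := by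
  intro h
  have h1 : mu V Set.univ = 1 := measure_univ
  rw [mu, h] at h1
  simp at h1

/-- Needed because `y` is integrated against Lebesgue measure: only so does the increment depend on
the `μ_V`-class of `f` alone. -/
theorem volume_absolutelyContinuous_mu (hV : Measurable V) [IsProbabilityMeasure (mu V)] :
    volume ≪ mu V := by
  have h1 : (volume : Measure (EuclideanSpace ℝ (Fin d))) ≪ volume.withDensity
      (fun x => ENNReal.ofReal (Real.exp (-V x))) :=
    withDensity_absolutelyContinuous' (by fun_prop)
      (Eventually.of_forall fun x => by simp [Real.exp_pos])
  exact h1.trans (Measure.absolutelyContinuous_smul (ENNReal.inv_ne_zero.2 lintegral_exp_ne_top))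

/-- The normalized increment `(f(x) - f(y)) / |x - y|^((d + α) / 2)`, at `p = (x, y)`. -/
def increment (α : ℝ) (f : EuclideanSpace ℝ (Fin d) → ℝ)
    (p : EuclideanSpace ℝ (Fin d) × EuclideanSpace ℝ (Fin d)) : ℝ :=
  (f p.1 - f p.2) / ‖p.1 - p.2‖ ^ (((d : ℝ) + α) / 2)

theorem increment_mul (f g : EuclideanSpace ℝ (Fin d) → ℝ)
    (p : EuclideanSpace ℝ (Fin d) × EuclideanSpace ℝ (Fin d)) :
    increment α f p * increment α g p =
      (f p.1 - f p.2) * (g p.1 - g p.2) / ‖p.1 - p.2‖ ^ ((d : ℝ) + α) := by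
  rw [increment, increment, div_mul_div_comm, ← sq, ← Real.rpow_natCast,
    ← Real.rpow_mul (norm_nonneg _)]
  norm_num

theorem energy_eq (f : EuclideanSpace ℝ (Fin d) → ℝ) :
    energy α V f = ∫⁻ p, ‖increment α f p‖ₑ ^ 2 ∂(prodMeasure V) := by
  refine lintegral_congr fun p => ?_
  rw [← enorm_pow, sq (increment α f p), increment_mul, ← sq, sq_abs,
    Real.enorm_of_nonneg (by positivity)]

theorem increment_congr (hV : Measurable V) [IsProbabilityMeasure (mu V)]
    {f g : EuclideanSpace ℝ (Fin d) → ℝ} (h : f =ᵐ[mu V] g) :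
    increment α f =ᵐ[prodMeasure V] increment α g := by
  have h1 := Measure.quasiMeasurePreserving_fst (μ := mu V)
    (ν := (volume : Measure (EuclideanSpace ℝ (Fin d)))) |>.ae_eq h
  have h2 := Measure.quasiMeasurePreserving_snd (μ := mu V)
    (ν := (volume : Measure (EuclideanSpace ℝ (Fin d)))) |>.ae_eq
    ((volume_absolutelyContinuous_mu hV).ae_eq h)
  filter_upwards [h1, h2] with p hp1 hp2
  simp only [Function.comp_apply] at hp1 hp2
  rw [increment, increment, hp1, hp2]

theorem energy_congr (hV : Measurable V) [IsProbabilityMeasure (mu V)]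
    {f g : EuclideanSpace ℝ (Fin d) → ℝ} (h : f =ᵐ[mu V] g) : energy α V f = energy α V g := by
  rw [energy_eq, energy_eq]
  refine lintegral_congr_ae ?_
  filter_upwards [increment_congr (α := α) hV h] with p hp
  rw [hp]

theorem InDomain.congr (hV : Measurable V) [IsProbabilityMeasure (mu V)]
    {f g : EuclideanSpace ℝ (Fin d) → ℝ} (hf : InDomain α V f) (h : f =ᵐ[mu V] g) :
    InDomain α V g :=
  ⟨hf.1.ae_eq h, energy_congr (α := α) hV h ▸ hf.2⟩

theorem aestronglyMeasurable_increment (hV : Measurable V) [IsProbabilityMeasure (mu V)]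
    {f : EuclideanSpace ℝ (Fin d) → ℝ} (hf : AEStronglyMeasurable f (mu V)) :
    AEStronglyMeasurable (increment α f) (prodMeasure V) := by
  have h1 : AEStronglyMeasurable (fun p : EuclideanSpace ℝ (Fin d) × EuclideanSpace ℝ (Fin d) =>
    f p.1) (prodMeasure V) := hf.comp_fst
  have h2 : AEStronglyMeasurable (fun p : EuclideanSpace ℝ (Fin d) × EuclideanSpace ℝ (Fin d) =>
    f p.2) (prodMeasure V) := (hf.mono_ac (volume_absolutelyContinuous_mu hV)).comp_snd
  have h3 : Measurable fun p : EuclideanSpace ℝ (Fin d) × EuclideanSpace ℝ (Fin d) =>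
    ‖p.1 - p.2‖ ^ (((d : ℝ) + α) / 2) := by fun_prop
  exact (h1.sub h2).div₀ h3.aestronglyMeasurable

theorem memLp_increment_iff (hV : Measurable V) [IsProbabilityMeasure (mu V)]
    {f : EuclideanSpace ℝ (Fin d) → ℝ} (hf : AEStronglyMeasurable f (mu V)) :
    MemLp (increment α f) 2 (prodMeasure V) ↔ energy α V f < ∞ := by
  rw [MemLp, and_iff_right (aestronglyMeasurable_increment hV hf),
    eLpNorm_lt_top_iff_lintegral_rpow_enorm_lt_top two_ne_zero ENNReal.ofNat_ne_top, energy_eq]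
  norm_num

/-- The graph of the closed operator `f ↦ increment α f`. -/
def incrementGraph (α : ℝ) (hV : Measurable V) [IsProbabilityMeasure (mu V)] :
    Submodule ℝ (Lp ℝ 2 (mu V) × Lp ℝ 2 (prodMeasure V)) where
  carrier := {p | (p.2 : EuclideanSpace ℝ (Fin d) × EuclideanSpace ℝ (Fin d) → ℝ)
    =ᵐ[prodMeasure V] increment α p.1}
  zero_mem' := by
    have h1 := increment_congr (α := α) hV (Lp.coeFn_zero ℝ 2 (mu V))
    filter_upwards [h1, Lp.coeFn_zero ℝ 2 (prodMeasure V)] with p h1 h2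
    change (0 : Lp ℝ 2 (prodMeasure V)) p = increment α (0 : Lp ℝ 2 (mu V)) p
    rw [h1, h2]
    simp [increment]
  add_mem' := by
    intro p q hp hq
    have h1 := increment_congr (α := α) hV (Lp.coeFn_add p.1 q.1)
    change (p + q).2 =ᵐ[prodMeasure V] increment α (p + q).1
    filter_upwards [h1, Lp.coeFn_add p.2 q.2, hp, hq] with x h1 h2 h3 h4
    rw [Prod.fst_add, Prod.snd_add, h1, h2, Pi.add_apply, h3, h4]
    simp only [increment, Pi.add_apply]
    ring
  smul_mem' := by
    intro c p hp
    have h1 := increment_congr (α := α) hV (Lp.coeFn_smul c p.1)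
    change (c • p).2 =ᵐ[prodMeasure V] increment α (c • p).1
    filter_upwards [h1, Lp.coeFn_smul c p.2, hp] with x h1 h2 h3
    rw [Prod.smul_fst, Prod.smul_snd, h1, h2, Pi.smul_apply, h3]
    simp only [increment, Pi.smul_apply, smul_eq_mul]
    ring

section Graph

variable (hV : Measurable V) [IsProbabilityMeasure (mu V)]

theorem mem_incrementGraph {f : Lp ℝ 2 (mu V)} {k : Lp ℝ 2 (prodMeasure V)} :
    (f, k) ∈ incrementGraph α hV ↔ k =ᵐ[prodMeasure V] increment α f := Iff.rfl

theorem inDomain_iff_exists_mem {f : Lp ℝ 2 (mu V)} :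
    InDomain α V f ↔ ∃ k, (f, k) ∈ incrementGraph α hV := by
  constructor
  · intro h
    have h1 := (memLp_increment_iff hV h.1.1).2 h.2
    exact ⟨h1.toLp _, h1.coeFn_toLp⟩
  · rintro ⟨k, hk⟩
    exact ⟨Lp.memLp f, (memLp_increment_iff hV (Lp.aestronglyMeasurable f)).1
      ((Lp.memLp k).ae_eq hk)⟩

theorem exists_mem_incrementGraph_of_inDomain {f : EuclideanSpace ℝ (Fin d) → ℝ}
    (h : InDomain α V f) : ∃ k, (h.1.toLp f, k) ∈ incrementGraph α hV :=
  (inDomain_iff_exists_mem hV).1 (h.congr hV h.1.coeFn_toLp.symm)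

theorem form_eq_inner {f h : Lp ℝ 2 (mu V)} {k l : Lp ℝ 2 (prodMeasure V)}
    (hf : (f, k) ∈ incrementGraph α hV) (hh : (h, l) ∈ incrementGraph α hV) :
    form α V f h = inner ℝ k l := by
  rw [L2.inner_def, form]
  refine integral_congr_ae ?_
  filter_upwards [hf, hh] with p h1 h2
  rw [h1, h2, ← increment_mul]
  simp [mul_comm]

theorem energy_eq_ofReal_norm_sq {f : Lp ℝ 2 (mu V)} {k : Lp ℝ 2 (prodMeasure V)}
    (hf : (f, k) ∈ incrementGraph α hV) : energy α V f = ENNReal.ofReal (‖k‖ ^ 2) := by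
  rw [← real_inner_self_eq_norm_sq, L2.inner_def, ofReal_integral_eq_lintegral_ofReal
    (L2.integrable_inner k k) (Eventually.of_forall fun p => real_inner_self_nonneg), energy_eq]
  refine lintegral_congr_ae ?_
  filter_upwards [hf] with p hp
  rw [hp, real_inner_self_eq_norm_sq, ENNReal.ofReal_pow (norm_nonneg _), ofReal_norm]

theorem mem_formOperator_incrementGraph {f g : Lp ℝ 2 (mu V)} :
    (f, g) ∈ formOperator (incrementGraph α hV) ↔
      InDomain α V f ∧ ∀ h : Lp ℝ 2 (mu V), InDomain α V h → form α V f h = -inner ℝ g h := by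
  rw [mem_formOperator]
  constructor
  · rintro ⟨k, hk, h⟩
    refine ⟨(inDomain_iff_exists_mem hV).2 ⟨k, hk⟩, fun u hu => ?_⟩
    obtain ⟨l, hl⟩ := (inDomain_iff_exists_mem hV).1 hu
    rw [form_eq_inner hV hk hl, h u l hl]
  · rintro ⟨hf, h⟩
    obtain ⟨k, hk⟩ := (inDomain_iff_exists_mem hV).1 hf
    refine ⟨k, hk, fun u l hl => ?_⟩
    rw [← form_eq_inner hV hk hl, h u ((inDomain_iff_exists_mem hV).2 ⟨l, hl⟩)]

theorem isAssociatedSemigroup_iff {P : ℝ≥0 → Lp ℝ 2 (mu V) →L[ℝ] Lp ℝ 2 (mu V)} :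
    IsAssociatedSemigroup α V P ↔ IsSemigroupOf (formOperator (incrementGraph α hV)) P :=
  ⟨fun h => ⟨h.1, h.2, h.3, fun f g => (h.4 f g).trans (mem_formOperator_incrementGraph hV).symm⟩,
    fun h => ⟨h.1, h.2, h.3, fun f g => (h.4 f g).trans (mem_formOperator_incrementGraph hV)⟩⟩

/-- Along a subsequence the functions converge a.e., and along a further one so do the increments.
Pointwise increments pass to the limit, which identifies the limit increment. -/
theorem isClosed_incrementGraph :
    IsClosed (incrementGraph α hV : Set (Lp ℝ 2 (mu V) × Lp ℝ 2 (prodMeasure V))) := by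
  refine IsSeqClosed.isClosed fun u p hu hup => ?_
  rw [SetLike.mem_coe]
  have h1 : Tendsto (fun n => (u n).1) atTop (𝓝 p.1) := (continuous_fst.tendsto p).comp hup
  have h2 : Tendsto (fun n => (u n).2) atTop (𝓝 p.2) := (continuous_snd.tendsto p).comp hup
  obtain ⟨ns, hns, hae⟩ := (tendstoInMeasure_of_tendsto_Lp h1).exists_seq_tendsto_ae
  obtain ⟨ms, hms, hae2⟩ := (tendstoInMeasure_of_tendsto_Lp
    (h2.comp hns.tendsto_atTop)).exists_seq_tendsto_ae
  have h3 := Measure.quasiMeasurePreserving_fst (μ := mu V)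
    (ν := (volume : Measure (EuclideanSpace ℝ (Fin d)))) |>.ae hae
  have h4 := Measure.quasiMeasurePreserving_snd (μ := mu V)
    (ν := (volume : Measure (EuclideanSpace ℝ (Fin d)))) |>.ae
    ((volume_absolutelyContinuous_mu hV).ae_le hae)
  have h5 : ∀ᵐ x ∂(prodMeasure V), ∀ n, (u n).2 x = increment α (u n).1 x :=
    ae_all_iff.2 fun n => hu n
  change p.2 =ᵐ[prodMeasure V] increment α p.1
  filter_upwards [h3, h4, h5, hae2] with x h3 h4 h5 h6
  refine tendsto_nhds_unique h6 ?_
  have h7 := ((h3.sub h4).div_const (‖x.1 - x.2‖ ^ (((d : ℝ) + α) / 2))).comp hms.tendsto_atTop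
  exact h7.congr fun n => (h5 _).symm

end Graph

end

/-! ### Energy bounds, density of the domain and the sup-norm contraction -/

section
variable {d : ℕ} {α : ℝ} {V : EuclideanSpace ℝ (Fin d) → ℝ}

/-- The function `min(|z|, 1)² / |z|^(d + α)`. -/
def truncatedKernel (d : ℕ) (α : ℝ) (z : EuclideanSpace ℝ (Fin d)) : ℝ :=
  min ‖z‖ 1 ^ 2 / ‖z‖ ^ ((d : ℝ) + α)

theorem truncatedKernel_nonneg (z : EuclideanSpace ℝ (Fin d)) : 0 ≤ truncatedKernel d α z := by
  unfold truncatedKernel; positivity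

theorem measurable_truncatedKernel : Measurable (truncatedKernel d α) := by
  unfold truncatedKernel; fun_prop

theorem nontrivial_euclideanSpace (hd : 1 ≤ d) : Nontrivial (EuclideanSpace ℝ (Fin d)) := by
  have : Nonempty (Fin d) := ⟨⟨0, hd⟩⟩
  exact Module.nontrivial_of_finrank_pos (R := ℝ) (by rw [finrank_euclideanSpace_fin]; exact hd)

/-- In polar coordinates the radial integrand is `s^(1-α)` near zero, integrable as `α < 2`, and
`s^(-1-α)` at infinity, integrable as `α > 0`. -/
theorem integrable_truncatedKernel (hd : 1 ≤ d) (hα0 : 0 < α) (hα2 : α < 2) :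
    Integrable (truncatedKernel d α) := by
  have := nontrivial_euclideanSpace hd
  have key : IntegrableOn (fun s : ℝ => s ^ (d - 1) • (min s 1 ^ 2 / s ^ ((d : ℝ) + α)))
      (Set.Ioi 0) := by
    rw [← Set.Ioc_union_Ioi_eq_Ioi zero_le_one]
    have hpow : ∀ s : ℝ, 0 < s → s ^ (d - 1) = s ^ ((d : ℝ) - 1) := fun s hs => by
      rw [← Real.rpow_natCast, Nat.cast_sub hd, Nat.cast_one]
    refine IntegrableOn.union ?_ ?_
    · have h1 : IntegrableOn (fun s : ℝ => s ^ (1 - α)) (Set.Ioc 0 1) :=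
        (intervalIntegrable_iff_integrableOn_Ioc_of_le zero_le_one).1
          (intervalIntegral.intervalIntegrable_rpow' (by linarith))
      refine h1.congr_fun (fun s hs => ?_) measurableSet_Ioc
      have hs0 : 0 < s := hs.1
      simp only [min_eq_left hs.2, smul_eq_mul]
      rw [hpow s hs0, ← Real.rpow_natCast s 2, ← Real.rpow_sub hs0, ← Real.rpow_add hs0]
      congr 1
      push_cast
      ring
    · have h1 : IntegrableOn (fun s : ℝ => s ^ (-1 - α)) (Set.Ioi 1) :=
        integrableOn_Ioi_rpow_of_lt (by linarith) one_pos
      refine h1.congr_fun (fun s hs => ?_) measurableSet_Ioi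
      have hs1 : 1 < s := hs
      have hs0 : 0 < s := one_pos.trans hs1
      simp only [min_eq_right hs1.le, smul_eq_mul]
      rw [hpow s hs0, one_pow, one_div, ← Real.rpow_neg hs0.le, ← Real.rpow_add hs0]
      congr 1
      ring
  have h2 := (integrable_fun_norm_addHaar (volume : Measure (EuclideanSpace ℝ (Fin d)))
    (f := fun s : ℝ => min s 1 ^ 2 / s ^ ((d : ℝ) + α))).2
  rw [finrank_euclideanSpace_fin] at h2
  exact h2 key

/-- Energy bound for functions at distance scale `R`: the energy of a bounded Lipschitz function
decays like `R ^ (-α)`. -/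
theorem energy_le_of_abs_sub_le [IsProbabilityMeasure (mu V)] (hd : 1 ≤ d) (hα0 : 0 < α)
    (hα2 : α < 2) {f : EuclideanSpace ℝ (Fin d) → ℝ} {C R : ℝ} (hR : 0 < R)
    (hf : ∀ x y, |f x - f y| ≤ C * min (‖x - y‖ / R) 1) :
    energy α V f ≤ ENNReal.ofReal (C ^ 2 * R ^ (-α) * ∫ z, truncatedKernel d α z) := by
  -- This dominates the energy integrand as a function of `x - y`. The prefactor `R^(-(d+α))` and
  -- the Jacobian `R^d` of the dilation combine to `R^(-α)`.
  set φ : EuclideanSpace ℝ (Fin d) → ℝ := fun z =>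
    C ^ 2 * R ^ (-((d : ℝ) + α)) * truncatedKernel d α (R⁻¹ • z) with hφ
  have hφi : Integrable φ :=
    ((integrable_truncatedKernel hd hα0 hα2).comp_smul (inv_ne_zero hR.ne')).const_mul _
  have hφm : Measurable φ := by
    have := measurable_truncatedKernel (d := d) (α := α)
    fun_prop
  have hφ0 : ∀ z, 0 ≤ φ z := fun z => by
    have := truncatedKernel_nonneg (α := α) (R⁻¹ • z)
    positivity
  have hpt : ∀ x y, |f x - f y| ^ 2 / ‖x - y‖ ^ ((d : ℝ) + α) ≤ φ (x - y) := by
    intro x y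
    have h1 : φ (x - y) = (C * min (‖x - y‖ / R) 1) ^ 2 / ‖x - y‖ ^ ((d : ℝ) + α) := by
      simp only [hφ, truncatedKernel, norm_smul, norm_inv, Real.norm_of_nonneg hR.le]
      rw [Real.mul_rpow (by positivity) (norm_nonneg _), Real.inv_rpow hR.le, Real.rpow_neg hR.le,
        inv_mul_eq_div]
      have : 0 < R ^ ((d : ℝ) + α) := Real.rpow_pos_of_pos hR _
      field_simp
    rw [h1]
    gcongr
    exact hf x y
  calc energy α V f ≤ ∫⁻ p, ENNReal.ofReal (φ (p.1 - p.2)) ∂(prodMeasure V) :=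
        lintegral_mono fun p => ENNReal.ofReal_le_ofReal (hpt p.1 p.2)
    _ = ∫⁻ x, ∫⁻ y, ENNReal.ofReal (φ (x - y)) ∂volume ∂(mu V) := by
        rw [lintegral_prod _ (by fun_prop)]
    _ = ∫⁻ _, ENNReal.ofReal (∫ z, φ z) ∂(mu V) := by
        refine lintegral_congr fun x => ?_
        rw [lintegral_sub_left_eq_self (fun z => ENNReal.ofReal (φ z)) x,
          ofReal_integral_eq_lintegral_ofReal hφi (Eventually.of_forall hφ0)]
    _ = ENNReal.ofReal (∫ z, φ z) := by simp
    _ = _ := by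
        congr 1
        simp only [hφ]
        rw [integral_const_mul, Measure.integral_comp_smul, finrank_euclideanSpace_fin, smul_eq_mul,
          inv_pow, inv_inv, abs_of_pos (by positivity), ← mul_assoc, mul_assoc (C ^ 2),
          ← Real.rpow_natCast R d, ← Real.rpow_add hR]
        congr 3
        ring

theorem inDomain_of_lipschitz [IsProbabilityMeasure (mu V)] (hd : 1 ≤ d) (hα0 : 0 < α)
    (hα2 : α < 2) {f : EuclideanSpace ℝ (Fin d) → ℝ} {L : ℝ≥0} (hL : LipschitzWith L f) {M : ℝ}
    (hM : ∀ x, |f x| ≤ M) : InDomain α V f := by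
  refine ⟨MemLp.of_bound hL.continuous.aestronglyMeasurable M (Eventually.of_forall hM), ?_⟩
  refine (energy_le_of_abs_sub_le hd hα0 hα2 (C := max (L : ℝ) (2 * M)) one_pos fun x y => ?_).trans_lt
    ENNReal.ofReal_lt_top
  have h1 : |f x - f y| ≤ max (L : ℝ) (2 * M) * ‖x - y‖ := by
    have := hL.dist_le_mul x y
    rw [dist_eq_norm, dist_eq_norm, Real.norm_eq_abs] at this
    exact this.trans (mul_le_mul_of_nonneg_right (le_max_left _ _) (norm_nonneg _))
  have h2 : |f x - f y| ≤ max (L : ℝ) (2 * M) * 1 := by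
    rw [mul_one]
    have := abs_sub (f x) (f y)
    exact le_trans (by linarith [hM x, hM y]) (le_max_right _ _)
  rw [div_one]
  rcases min_choice ‖x - y‖ 1 with h | h <;> rw [h] <;> assumption

theorem inDomain_comp {f : EuclideanSpace ℝ (Fin d) → ℝ}
    (hf : InDomain α V f) {φ : ℝ → ℝ} (hφ : LipschitzWith 1 φ) (h0 : φ 0 = 0) :
    InDomain α V (fun x => φ (f x)) := by
  refine ⟨hφ.comp_memLp h0 hf.1, lt_of_le_of_lt (lintegral_mono fun p => ?_) hf.2⟩
  have := hφ.dist_le_mul (f p.1) (f p.2)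
  rw [NNReal.coe_one, one_mul, Real.dist_eq, Real.dist_eq] at this
  gcongr

section Graph

variable (hV : Measurable V) [IsProbabilityMeasure (mu V)]

theorem incrementGraph_dense (hd : 1 ≤ d) (hα0 : 0 < α) (hα2 : α < 2) (f : Lp ℝ 2 (mu V))
    (ε : ℝ) (hε : 0 < ε) : ∃ h l, (h, l) ∈ incrementGraph α hV ∧ ‖f - h‖ < ε := by
  set D := (incrementGraph α hV).map (LinearMap.fst ℝ _ _) with hD
  have htop : D.topologicalClosure = ⊤ := by
    rw [Submodule.topologicalClosure_eq_top_iff, Submodule.eq_bot_iff]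
    intro u hu
    rw [Lp.eq_zero_iff_ae_eq_zero]
    -- A vector orthogonal to the domain annihilates all smooth compactly supported functions, which
    -- are bounded and Lipschitz and so have finite energy.
    refine ae_eq_zero_of_integral_contDiff_smul_eq_zero
      ((Lp.memLp u).integrable one_le_two).locallyIntegrable fun g hg hgc => ?_
    obtain ⟨L, hL⟩ := hg.lipschitzWith_of_hasCompactSupport hgc (by simp)
    obtain ⟨M, hM⟩ := hgc.exists_bound_of_continuous hg.continuous
    have hgd : InDomain α V g := inDomain_of_lipschitz hd hα0 hα2 hL hM
    obtain ⟨k, hk⟩ := exists_mem_incrementGraph_of_inDomain hV hgd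
    have := (Submodule.mem_orthogonal _ _).1 hu _ ⟨_, hk, rfl⟩
    rw [L2.inner_def] at this
    rw [← this]
    refine integral_congr_ae ?_
    filter_upwards [hgd.1.coeFn_toLp] with x hx
    simp only [LinearMap.fst_apply]
    rw [hx]
    simp [mul_comm]
  have hf : f ∈ closure (D : Set (Lp ℝ 2 (mu V))) := by
    rw [← Submodule.topologicalClosure_coe, htop]; trivial
  obtain ⟨h, ⟨⟨h', l⟩, hl, rfl⟩, hfh⟩ := Metric.mem_closure_iff.1 hf ε hε
  exact ⟨h', l, hl, by rwa [← dist_eq_norm]⟩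

/-- The resolvent is a contraction for the supremum norm. -/
theorem abs_resolvent_le {J : ℕ → Lp ℝ 2 (mu V) →L[ℝ] Lp ℝ 2 (mu V)}
    (hJ : IsMaxDissipative (formOperator (incrementGraph α hV)) J) {M : ℝ} (hM : 0 ≤ M)
    {f : Lp ℝ 2 (mu V)} (hf : ∀ᵐ x ∂(mu V), |f x| ≤ M) (n : ℕ) :
    ∀ᵐ x ∂(mu V), |J n f x| ≤ M := by
  -- The overshoot of `u = J n f` beyond `[-M, M]` serves as test function. As `φ` is nondecreasing,
  -- the form of `u` and `φ(u)` is nonnegative, so the resolvent equation gives `⟨u - f, φ(u)⟩ ≤ 0`.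
  -- Since `|f| ≤ M`, that product dominates `φ(u)²`, so the overshoot vanishes.
  set φ : ℝ → ℝ := fun s => s - max (-M) (min s M) with hφ
  have hφcases : ∀ s, φ s = 0 ∧ |s| ≤ M ∨ φ s = s - M ∧ M < s ∨ φ s = s + M ∧ s < -M := by
    intro s
    simp only [hφ]
    rcases le_or_gt s M with h1 | h1
    · rcases le_or_gt (-M) s with h2 | h2
      · left; rw [min_eq_left h1, max_eq_right h2]; exact ⟨sub_self s, abs_le.2 ⟨h2, h1⟩⟩
      · right; right; rw [min_eq_left h1, max_eq_left h2.le]; exact ⟨by ring, h2⟩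
    · right; left; rw [min_eq_right h1.le, max_eq_right (by linarith)]; exact ⟨rfl, h1⟩
  have hmono : ∀ s t, s ≤ t → φ s ≤ φ t ∧ φ t - φ s ≤ t - s := by
    intro s t hst
    rcases hφcases s with ⟨h1, h2⟩ | ⟨h1, h2⟩ | ⟨h1, h2⟩ <;>
    rcases hφcases t with ⟨h3, h4⟩ | ⟨h3, h4⟩ | ⟨h3, h4⟩ <;> rw [h1, h3] <;>
    constructor <;> (try rw [abs_le] at h2) <;> (try rw [abs_le] at h4) <;> linarith
  have hlip : LipschitzWith 1 φ := LipschitzWith.of_dist_le_mul fun s t => by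
    rw [NNReal.coe_one, one_mul, Real.dist_eq, Real.dist_eq]
    rcases le_total s t with h | h
    · rw [abs_sub_comm, abs_sub_comm s, abs_of_nonneg (sub_nonneg.2 (hmono s t h).1),
        abs_of_nonneg (sub_nonneg.2 h)]
      exact (hmono s t h).2
    · rw [abs_of_nonneg (sub_nonneg.2 (hmono t s h).1), abs_of_nonneg (sub_nonneg.2 h)]
      exact (hmono t s h).2
  have h0 : φ 0 = 0 := by simp [hφ, hM]
  obtain ⟨k, hk, hkl⟩ := hJ.resolvent_mem n f
  simp only at hk hkl
  set u := J n f with hu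
  have hvd := inDomain_comp ((inDomain_iff_exists_mem hV).2 ⟨k, hk⟩) hlip h0
  obtain ⟨l, hl⟩ := exists_mem_incrementGraph_of_inDomain hV hvd
  set v := hvd.1.toLp _ with hv
  have hvx : v =ᵐ[mu V] fun x => φ (u x) := hvd.1.coeFn_toLp
  have h1 : 0 ≤ inner ℝ k l := by
    rw [L2.inner_def]
    refine integral_nonneg_of_ae ?_
    filter_upwards [hk, hl, increment_congr (α := α) hV hvx] with p h1 h2 h3
    rw [h1, h2, h3]
    simp only [RCLike.inner_apply, conj_trivial, Pi.zero_apply]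
    rw [increment_mul]
    refine div_nonneg ?_ (by positivity)
    rcases le_total (u p.1) (u p.2) with h | h
    · exact mul_nonneg_of_nonpos_of_nonpos (sub_nonpos.2 (hmono _ _ h).1) (sub_nonpos.2 h)
    · exact mul_nonneg (sub_nonneg.2 (hmono _ _ h).1) (sub_nonneg.2 h)
  rw [hkl v l hl, real_inner_smul_left] at h1
  have h2 : inner ℝ (u - f) v ≤ 0 := by
    by_contra! h
    have := mul_pos (show (0 : ℝ) < n + 1 by positivity) h
    linarith
  have h3 : ‖v‖ ^ 2 ≤ 0 := by
    refine le_trans ?_ h2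
    rw [← real_inner_self_eq_norm_sq, L2.inner_def, L2.inner_def]
    refine integral_mono_ae (L2.integrable_inner _ _) (L2.integrable_inner _ _) ?_
    filter_upwards [hvx, hf, Lp.coeFn_sub u f] with x h1 h2 h3
    rw [h3, Pi.sub_apply]
    simp only [RCLike.inner_apply, conj_trivial]
    rw [h1]
    rw [abs_le] at h2
    rcases hφcases (u x) with ⟨h4, h5⟩ | ⟨h4, h5⟩ | ⟨h4, h5⟩ <;> rw [h4]
    · simp
    · exact mul_le_mul_of_nonneg_left (by linarith) (by linarith)
    · nlinarith
  have h4 : v = 0 := norm_eq_zero.1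
    ((pow_eq_zero_iff two_ne_zero).1 (le_antisymm h3 (sq_nonneg _)))
  filter_upwards [hvx, (Lp.eq_zero_iff_ae_eq_zero).1 h4] with x h5 h6
  rw [h6, Pi.zero_apply] at h5
  rcases hφcases (u x) with ⟨_, h8⟩ | ⟨h7, h8⟩ | ⟨h7, h8⟩
  · exact h8
  · linarith
  · linarith

end Graph

end

/-! ### Bounded mean-zero functions and decay of the semigroup -/

section
variable {d : ℕ} {α : ℝ} {V : EuclideanSpace ℝ (Fin d) → ℝ}

/-- The functions in `L²(μ_V)` with mean zero and bounded by `M`. -/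
def boundedMeanZero (V : EuclideanSpace ℝ (Fin d) → ℝ) (M : ℝ) : Set (Lp ℝ 2 (mu V)) :=
  {f | (∀ᵐ x ∂(mu V), |f x| ≤ M) ∧ ∫ x, f x ∂(mu V) = 0}

theorem inner_const_eq_integral [IsProbabilityMeasure (mu V)] (f : Lp ℝ 2 (mu V)) (c : ℝ) :
    inner ℝ f (Lp.const 2 (mu V) c) = c * ∫ x, f x ∂(mu V) := by
  rw [L2.inner_def, ← integral_const_mul]
  refine integral_congr_ae ?_
  filter_upwards [Lp.coeFn_const (p := 2) (μ := mu V) c] with x hx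
  rw [hx]
  simp

theorem integral_eq_zero_iff_inner [IsProbabilityMeasure (mu V)] (f : Lp ℝ 2 (mu V)) :
    ∫ x, f x ∂(mu V) = 0 ↔ inner ℝ f (Lp.const 2 (mu V) (1 : ℝ)) = 0 := by
  rw [inner_const_eq_integral, one_mul]

theorem isClosed_boundedMeanZero [IsProbabilityMeasure (mu V)] (M : ℝ) :
    IsClosed (boundedMeanZero V M) := by
  refine IsSeqClosed.isClosed fun u f hu huf => ⟨?_, ?_⟩
  · obtain ⟨ns, -, hae⟩ := (tendstoInMeasure_of_tendsto_Lp huf).exists_seq_tendsto_ae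
    have h1 : ∀ᵐ x ∂(mu V), ∀ n, |u n x| ≤ M := ae_all_iff.2 fun n => (hu n).1
    filter_upwards [hae, h1] with x h2 h3
    exact le_of_tendsto' h2.abs fun n => h3 _
  · rw [integral_eq_zero_iff_inner]
    refine tendsto_nhds_unique (huf.inner tendsto_const_nhds) (tendsto_const_nhds.congr fun n => ?_)
    exact ((integral_eq_zero_iff_inner _).1 (hu n).2).symm

theorem convex_boundedMeanZero [IsProbabilityMeasure (mu V)] (M : ℝ) :
    Convex ℝ (boundedMeanZero V M) := by
  intro f hf g hg a b ha hb hab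
  refine ⟨?_, ?_⟩
  · filter_upwards [Lp.coeFn_add (a • f) (b • g), Lp.coeFn_smul a f, Lp.coeFn_smul b g, hf.1, hg.1]
      with x h1 h2 h3 h4 h5
    rw [h1, Pi.add_apply, h2, h3, Pi.smul_apply, Pi.smul_apply, smul_eq_mul, smul_eq_mul]
    refine (abs_add_le _ _).trans ?_
    rw [abs_mul, abs_mul, abs_of_nonneg ha, abs_of_nonneg hb]
    calc a * |f x| + b * |g x| ≤ a * M + b * M := by gcongr
      _ = M := by rw [← add_mul, hab, one_mul]
  · rw [integral_eq_zero_iff_inner, inner_add_left, real_inner_smul_left, real_inner_smul_left,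
      (integral_eq_zero_iff_inner f).1 hf.2, (integral_eq_zero_iff_inner g).1 hg.2]
    simp

theorem zero_mem_boundedMeanZero [IsProbabilityMeasure (mu V)] {M : ℝ} (hM : 0 ≤ M) :
    (0 : Lp ℝ 2 (mu V)) ∈ boundedMeanZero V M := by
  refine ⟨?_, by rw [integral_eq_zero_iff_inner, inner_zero_left]⟩
  filter_upwards [Lp.coeFn_zero ℝ 2 (mu V)] with x hx
  rw [hx]
  simpa using hM

theorem lintegral_sq_eq_ofReal_norm_sq (f : Lp ℝ 2 (mu V)) :
    ∫⁻ x, ENNReal.ofReal (f x ^ 2) ∂(mu V) = ENNReal.ofReal (‖f‖ ^ 2) := by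
  rw [← real_inner_self_eq_norm_sq, L2.inner_def, ofReal_integral_eq_lintegral_ofReal
    (L2.integrable_inner f f) (Eventually.of_forall fun p => real_inner_self_nonneg)]
  refine lintegral_congr fun x => ?_
  rw [real_inner_self_eq_norm_sq, Real.norm_eq_abs, sq_abs]

section Graph

variable (hV : Measurable V) [IsProbabilityMeasure (mu V)]

theorem const_mem_incrementGraph (c : ℝ) :
    (Lp.const 2 (mu V) c, 0) ∈ incrementGraph α hV := by
  rw [mem_incrementGraph]
  filter_upwards [Lp.coeFn_zero ℝ 2 (prodMeasure V),
    increment_congr (α := α) hV (Lp.coeFn_const (p := 2) (μ := mu V) c)] with p h1 h2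
  rw [h1, h2]
  simp [increment]

theorem const_mem_formOperator (c : ℝ) :
    (Lp.const 2 (mu V) c, 0) ∈ formOperator (incrementGraph α hV) :=
  mem_formOperator.2 ⟨0, const_mem_incrementGraph hV c, fun h l _ => by simp⟩

/-- Constants have zero increment, so testing the resolvent equation with `1` shows that the mean is
preserved. -/
theorem resolvent_mem_boundedMeanZero {J : ℕ → Lp ℝ 2 (mu V) →L[ℝ] Lp ℝ 2 (mu V)}
    (hJ : IsMaxDissipative (formOperator (incrementGraph α hV)) J) {M : ℝ} (hM : 0 ≤ M) (n : ℕ) :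
    Set.MapsTo (J n) (boundedMeanZero V M) (boundedMeanZero V M) := by
  intro f hf
  refine ⟨abs_resolvent_le hV hJ hM hf.1 n, ?_⟩
  obtain ⟨k, hk, hkl⟩ := hJ.resolvent_mem n f
  have h1 := hkl _ _ (const_mem_incrementGraph hV 1)
  rw [inner_zero_right, real_inner_smul_left, inner_sub_left,
    (integral_eq_zero_iff_inner f).1 hf.2, sub_zero] at h1
  rw [integral_eq_zero_iff_inner]
  have h2 : (n : ℝ) + 1 ≠ 0 := by positivity
  simpa [h2] using h1

/-- The weak Poincaré inequality for elements of the domain of the generator. -/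
theorem WeakPoincare.norm_sq_le {β : ℝ → ℝ} (hW : WeakPoincare α V β) {r : ℝ} (hr : 0 < r)
    (hβ : 0 ≤ β r) {f g : Lp ℝ 2 (mu V)} (hfg : (f, g) ∈ formOperator (incrementGraph α hV))
    {M : ℝ} (hM : 0 ≤ M) (hf : f ∈ boundedMeanZero V M) :
    ‖f‖ ^ 2 ≤ -(β r * inner ℝ f g) + r * M ^ 2 := by
  obtain ⟨k, hk, hkl⟩ := hfg
  have h1 := hW r hr f ((inDomain_iff_exists_mem hV).2 ⟨k, hk⟩) hf.2
  have h2 : eLpNorm f ∞ (mu V) ≤ ENNReal.ofReal M := by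
    rw [eLpNorm_exponent_top]
    refine eLpNormEssSup_le_of_ae_bound ?_
    filter_upwards [hf.1] with x hx using hx
  have h3 := hkl _ _ hk
  rw [real_inner_self_eq_norm_sq, real_inner_comm] at h3
  rw [lintegral_sq_eq_ofReal_norm_sq, energy_eq_ofReal_norm_sq hV hk, h3,
    ← ENNReal.ofReal_mul hβ] at h1
  have h4 : ENNReal.ofReal r * eLpNorm f ∞ (mu V) ^ 2 ≤ ENNReal.ofReal (r * M ^ 2) := by
    rw [ENNReal.ofReal_mul hr.le, ENNReal.ofReal_pow hM]
    gcongr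
  have h5 : 0 ≤ β r * -inner ℝ f g := by
    have : (0 : ℝ) ≤ -inner ℝ f g := by
      have := sq_nonneg ‖k‖
      rw [h3] at this
      exact this
    positivity
  have h6 := h1.trans (add_le_add_right h4 _)
  rw [← ENNReal.ofReal_add h5 (by positivity), ENNReal.ofReal_le_ofReal_iff (by positivity)] at h6
  linarith

end Graph

/-- Existence and uniqueness of the semigroup of the form, and its decay under a weak Poincaré
inequality. -/
theorem exists_isAssociatedSemigroup (hV : Measurable V) [IsProbabilityMeasure (mu V)]
    (hd : 1 ≤ d) (hα0 : 0 < α) (hα2 : α < 2) :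
    ∃ P : ℝ≥0 → Lp ℝ 2 (mu V) →L[ℝ] Lp ℝ 2 (mu V), IsAssociatedSemigroup α V P ∧
      (∀ Q, IsAssociatedSemigroup α V Q → Q = P) ∧
      ∀ β : ℝ → ℝ, WeakPoincare α V β → ∀ r, 0 < r → 0 < β r → ∀ t : ℝ≥0,
        normSubMean V (P t) ^ 2 ≤
          ENNReal.ofReal (4 * Real.exp (-(2 * t / β r)) + 4 * r) := by
  obtain ⟨J, hJ⟩ := exists_isMaxDissipative_formOperator (isClosed_incrementGraph (α := α) hV)
    (incrementGraph_dense hV hd hα0 hα2)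
  obtain ⟨P, hP, hinv⟩ := hJ.exists_isSemigroupOf
  refine ⟨P, (isAssociatedSemigroup_iff hV).2 hP, fun Q hQ =>
    IsSemigroupOf.eq_of_isMaxDissipative hJ hP ((isAssociatedSemigroup_iff hV).1 hQ), ?_⟩
  intro β hW r hr hβ t
  -- The bound is `2` because `|f - μ_V(f)| ≤ 2` when `|f| ≤ 1`.
  have hmem : ∀ t, Set.MapsTo (P t) (boundedMeanZero V 2) (boundedMeanZero V 2) :=
    hinv _ (isClosed_boundedMeanZero 2) (convex_boundedMeanZero 2)
      (zero_mem_boundedMeanZero zero_le_two)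
      (fun n => resolvent_mem_boundedMeanZero hV hJ zero_le_two n)
  have hdom : ∀ f g, (f, g) ∈ formOperator (incrementGraph α hV) → f ∈ boundedMeanZero V 2 →
      ‖P t f‖ ^ 2 ≤ Real.exp (-(2 * t / β r)) * ‖f‖ ^ 2 + r * 2 ^ 2 := fun f g hfg hf =>
    hP.norm_sq_le_of_weakPoincare hfg hβ (by positivity)
      (fun s => hW.norm_sq_le hV hr hβ.le (hP.apply_mem hfg s) zero_le_two (hmem s hf)) t
  -- The vectors `J n f` lie in the domain of the generator, stay in the invariant set and converge
  -- to `f`.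
  have hall : ∀ f, f ∈ boundedMeanZero V 2 →
      ‖P t f‖ ^ 2 ≤ Real.exp (-(2 * t / β r)) * ‖f‖ ^ 2 + r * 2 ^ 2 := by
    intro f hf
    have h1 := hJ.tendsto_resolvent f
    exact le_of_tendsto_of_tendsto' ((((P t).continuous.tendsto f).comp h1).norm.pow 2)
      (((h1.norm.pow 2).const_mul _).add_const _) fun n =>
        hdom _ _ (hJ.resolvent_mem n f) (resolvent_mem_boundedMeanZero hV hJ zero_le_two n hf)
  have hsup : normSubMean V (P t) ≤
      ENNReal.ofReal (√(4 * Real.exp (-(2 * t / β r)) + 4 * r)) := by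
    refine iSup₂_le fun f hf => ?_
    set c : ℝ := ∫ y, f y ∂(mu V) with hc
    have hf1 : ∀ᵐ x ∂(mu V), |f x| ≤ 1 := by
      filter_upwards [ae_le_eLpNormEssSup (f := f) (μ := mu V)] with x hx
      rw [eLpNorm_exponent_top] at hf
      have := hx.trans hf
      rwa [Real.enorm_eq_ofReal_abs, ENNReal.ofReal_le_one] at this
    have hc1 : |c| ≤ 1 := by
      have := norm_integral_le_of_norm_le_const (μ := mu V) (f := f) (C := 1) hf1
      simpa using this
    set g : Lp ℝ 2 (mu V) := f - Lp.const 2 (mu V) c with hg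
    have hgx : ∀ᵐ x ∂(mu V), g x = f x - c := by
      filter_upwards [Lp.coeFn_sub f (Lp.const 2 (mu V) c),
        Lp.coeFn_const (p := 2) (μ := mu V) c] with x h1 h2
      rw [h1, Pi.sub_apply, h2]
      rfl
    have hg2 : ∀ᵐ x ∂(mu V), |g x| ≤ 2 := by
      filter_upwards [hgx, hf1] with x h1 h2
      rw [h1]
      exact (abs_sub _ _).trans (by linarith)
    have hgmem : g ∈ boundedMeanZero V 2 := by
      refine ⟨hg2, ?_⟩
      rw [integral_congr_ae hgx, integral_sub ((Lp.memLp f).integrable one_le_two)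
        (integrable_const c)]
      simp [hc]
    have hgn : ‖g‖ ^ 2 ≤ 4 := by
      rw [← real_inner_self_eq_norm_sq, L2.inner_def]
      have h1 : ∫ x, inner ℝ (g x) (g x) ∂(mu V) ≤ ∫ _, (4 : ℝ) ∂(mu V) := by
        refine integral_mono_ae (L2.integrable_inner g g) (integrable_const _) ?_
        filter_upwards [hg2] with x hx
        rw [real_inner_self_eq_norm_sq, Real.norm_eq_abs]
        nlinarith [abs_nonneg (g x)]
      simpa using h1
    have hPg : P t g = P t f - Lp.const 2 (mu V) c := by
      rw [hg, map_sub, hP.apply_eq_self (const_mem_formOperator hV c)]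
    have heq : eLpNorm (fun x => P t f x - c) 2 (mu V) = ENNReal.ofReal ‖P t g‖ := by
      rw [Lp.norm_def, ENNReal.ofReal_toReal (Lp.eLpNorm_ne_top _), hPg]
      refine eLpNorm_congr_ae ?_
      filter_upwards [Lp.coeFn_sub (P t f) (Lp.const 2 (mu V) c),
        Lp.coeFn_const (p := 2) (μ := mu V) c] with x h1 h2
      rw [h1, Pi.sub_apply, h2]
      rfl
    rw [heq]
    refine ENNReal.ofReal_le_ofReal (Real.le_sqrt_of_sq_le ((hall g hgmem).trans ?_))
    nlinarith [mul_le_mul_of_nonneg_left hgn (Real.exp_pos (-(2 * t / β r))).le]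
  calc normSubMean V (P t) ^ 2
      ≤ ENNReal.ofReal (√(4 * Real.exp (-(2 * t / β r)) + 4 * r)) ^ 2 := by gcongr
    _ = _ := by
      rw [← ENNReal.ofReal_pow (Real.sqrt_nonneg _), Real.sq_sqrt (by positivity)]

end

/-! ### Tails of the measure with logarithmic potential -/

section
variable {d : ℕ} {ε : ℝ}

theorem hasDerivAt_log_rpow (hε : 1 < ε) {s : ℝ} (hs : 1 < s) :
    HasDerivAt (fun s => -(Real.log s ^ (1 - ε) / (ε - 1))) (s⁻¹ * Real.log s ^ (-ε)) s := by
  have h1 := (((Real.hasDerivAt_log (by linarith : s ≠ 0)).rpow_const (p := 1 - ε)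
    (Or.inl (Real.log_pos hs).ne')).div_const (ε - 1)).neg
  refine h1.congr_deriv ?_
  have : ε - 1 ≠ 0 := by linarith
  rw [show (1 - ε - 1) = -ε by ring]
  field_simp
  ring

theorem tendsto_log_rpow (hε : 1 < ε) :
    Tendsto (fun s => -(Real.log s ^ (1 - ε) / (ε - 1))) atTop (𝓝 0) := by
  have h1 := (((tendsto_rpow_neg_atTop (show 0 < ε - 1 by linarith)).comp
    Real.tendsto_log_atTop).div_const (ε - 1)).neg
  simpa [neg_sub] using h1

theorem integrableOn_inv_mul_log_rpow (hε : 1 < ε) {R : ℝ} (hR : 1 < R) :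
    IntegrableOn (fun s : ℝ => s⁻¹ * Real.log s ^ (-ε)) (Set.Ioi R) :=
  integrableOn_Ioi_deriv_of_nonneg (hasDerivAt_log_rpow hε hR).continuousAt.continuousWithinAt
    (fun s hs => hasDerivAt_log_rpow hε (hR.trans hs))
    (fun s hs => mul_nonneg (inv_nonneg.2 (by linarith [hs.out]))
      (Real.rpow_nonneg (Real.log_nonneg (by linarith [hs.out])) _)) (tendsto_log_rpow hε)

theorem integral_inv_mul_log_rpow (hε : 1 < ε) {R : ℝ} (hR : 1 < R) :
    ∫ s in Set.Ioi R, s⁻¹ * Real.log s ^ (-ε) = Real.log R ^ (1 - ε) / (ε - 1) := by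
  rw [integral_Ioi_of_hasDerivAt_of_tendsto
    (hasDerivAt_log_rpow hε hR).continuousAt.continuousWithinAt
    (fun s hs => hasDerivAt_log_rpow hε (hR.trans hs))
    (integrableOn_inv_mul_log_rpow hε hR) (tendsto_log_rpow hε)]
  ring

/-- The tail integral of `|x|^(-d) (log |x|)^(-ε)`. -/
theorem lintegral_norm_gt (hd : 1 ≤ d) (hε : 1 < ε) {R : ℝ} (hR : 1 < R) :
    ∫⁻ x in {x : EuclideanSpace ℝ (Fin d) | R < ‖x‖},
        ENNReal.ofReal ((‖x‖ ^ d)⁻¹ * Real.log ‖x‖ ^ (-ε)) =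
      ENNReal.ofReal (d * volume.real (Metric.ball (0 : EuclideanSpace ℝ (Fin d)) 1) / (ε - 1) *
        Real.log R ^ (1 - ε)) := by
  have := nontrivial_euclideanSpace hd
  set ψ : ℝ → ℝ := (Set.Ioi R).indicator fun s => (s ^ d)⁻¹ * Real.log s ^ (-ε) with hψ
  have hψ0 : ∀ s, 0 ≤ ψ s := fun s => Set.indicator_nonneg (fun s hs => by
    have hs' : R < s := hs
    exact mul_nonneg (inv_nonneg.2 (pow_nonneg (by linarith) _))
      (Real.rpow_nonneg (Real.log_nonneg (by linarith)) _)) s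
  have hmul : (fun s : ℝ => s ^ (d - 1) • ψ s) =
      (Set.Ioi R).indicator fun s => s⁻¹ * Real.log s ^ (-ε) := by
    funext s
    simp only [hψ, Set.indicator_apply, smul_eq_mul]
    split_ifs with h
    · have hs : s ≠ 0 := by have : R < s := h; linarith
      rw [← mul_assoc]
      congr 1
      obtain ⟨n, rfl⟩ : ∃ n, d = n + 1 := ⟨d - 1, by omega⟩
      rw [Nat.add_sub_cancel, pow_succ]
      field_simp
    · simp
  have hsub : Set.Ioi R ⊆ Set.Ioi 0 := Set.Ioi_subset_Ioi (by linarith)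
  have hint : Integrable (fun x : EuclideanSpace ℝ (Fin d) => ψ ‖x‖) := by
    rw [integrable_fun_norm_addHaar, finrank_euclideanSpace_fin, hmul,
      integrableOn_indicator_iff measurableSet_Ioi, Set.inter_eq_left.2 hsub]
    exact integrableOn_inv_mul_log_rpow hε hR
  have hval : ∫ x : EuclideanSpace ℝ (Fin d), ψ ‖x‖ =
      d * volume.real (Metric.ball (0 : EuclideanSpace ℝ (Fin d)) 1) / (ε - 1) *
        Real.log R ^ (1 - ε) := by
    rw [integral_fun_norm_addHaar, finrank_euclideanSpace_fin, hmul,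
      setIntegral_indicator measurableSet_Ioi, Set.inter_eq_right.2 hsub,
      integral_inv_mul_log_rpow hε hR, nsmul_eq_mul, smul_eq_mul]
    ring
  rw [← hval, ofReal_integral_eq_lintegral_ofReal hint (Eventually.of_forall fun x => hψ0 _),
    ← lintegral_indicator (measurableSet_lt measurable_const measurable_norm)]
  refine lintegral_congr fun x => ?_
  simp only [hψ, Set.indicator_apply, Set.mem_ofPred_eq, Set.mem_Ioi]
  split_ifs <;> simp

theorem one_le_log_exp_one_add_sq (s : ℝ) : 1 ≤ Real.log (Real.exp 1 + s ^ 2) := by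
  rw [Real.le_log_iff_exp_le (by positivity)]
  nlinarith [sq_nonneg s]

theorem exp_neg_logPotential (x : EuclideanSpace ℝ (Fin d)) :
    Real.exp (-logPotential d ε x) = (1 + ‖x‖ ^ 2) ^ (-((d : ℝ) / 2)) *
      Real.log (Real.exp 1 + ‖x‖ ^ 2) ^ (-ε) := by
  have := one_le_log_exp_one_add_sq ‖x‖
  rw [Real.rpow_def_of_pos (by positivity), Real.rpow_def_of_pos (by linarith), ← Real.exp_add,
    logPotential]
  congr 1
  ring

theorem logPotential_nonneg (hε : 0 ≤ ε) (x : EuclideanSpace ℝ (Fin d)) :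
    0 ≤ logPotential d ε x := by
  have h1 := Real.log_nonneg (one_le_log_exp_one_add_sq ‖x‖)
  have h2 := Real.log_nonneg (show 1 ≤ 1 + ‖x‖ ^ 2 by nlinarith [sq_nonneg ‖x‖])
  rw [logPotential]
  positivity

theorem measurable_logPotential : Measurable (logPotential d ε) := by
  unfold logPotential; fun_prop

theorem sq_rpow_neg_half {s : ℝ} (hs : 0 ≤ s) : (s ^ 2) ^ (-((d : ℝ) / 2)) = (s ^ d)⁻¹ := by
  rw [← Real.rpow_natCast s 2, ← Real.rpow_mul hs, ← Real.rpow_natCast, ← Real.rpow_neg hs]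
  congr 1
  push_cast
  ring

theorem exp_neg_logPotential_le (hε : 0 ≤ ε) {x : EuclideanSpace ℝ (Fin d)} (hx : 1 < ‖x‖) :
    Real.exp (-logPotential d ε x) ≤ (‖x‖ ^ d)⁻¹ * Real.log ‖x‖ ^ (-ε) := by
  have h1 := Real.log_pos hx
  have h0 : 0 < ‖x‖ := one_pos.trans hx
  rw [exp_neg_logPotential, ← sq_rpow_neg_half h0.le]
  refine mul_le_mul ?_ ?_ (Real.rpow_nonneg (by linarith [one_le_log_exp_one_add_sq ‖x‖]) _)
    (by positivity)
  · exact Real.rpow_le_rpow_of_nonpos (by positivity) (by linarith) (by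
      have : (0 : ℝ) ≤ d := by positivity
      linarith)
  · refine Real.rpow_le_rpow_of_nonpos h1 (Real.log_le_log h0 ?_) (by linarith)
    nlinarith [Real.exp_pos 1]

/-- The constants come from `1 + |x|² ≤ 2 |x|²` and `e + |x|² ≤ |x|³`, both valid for `|x| > 2`. -/
theorem le_exp_neg_logPotential (hε : 0 ≤ ε) {x : EuclideanSpace ℝ (Fin d)} (hx : 2 < ‖x‖) :
    2 ^ (-((d : ℝ) / 2)) * 3 ^ (-ε) * ((‖x‖ ^ d)⁻¹ * Real.log ‖x‖ ^ (-ε)) ≤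
      Real.exp (-logPotential d ε x) := by
  have h1 := Real.log_pos (by linarith : 1 < ‖x‖)
  have h0 : 0 < ‖x‖ := by linarith
  rw [exp_neg_logPotential, ← sq_rpow_neg_half h0.le, mul_mul_mul_comm,
    ← Real.mul_rpow (by positivity) (by positivity), ← Real.mul_rpow (by positivity) h1.le]
  have hd0 : (0 : ℝ) ≤ d := by positivity
  refine mul_le_mul ?_ ?_ (by positivity) (by positivity)
  · exact Real.rpow_le_rpow_of_nonpos (by positivity) (by nlinarith) (by linarith)
  · refine Real.rpow_le_rpow_of_nonpos (by linarith [one_le_log_exp_one_add_sq ‖x‖]) ?_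
      (by linarith)
    have h3 : 3 * Real.log ‖x‖ = Real.log (‖x‖ ^ 3) := by rw [Real.log_pow]; norm_num
    rw [h3]
    refine Real.log_le_log (by positivity) ?_
    have := Real.exp_one_lt_d9
    nlinarith [sq_nonneg (‖x‖ - 2), mul_pos h0 h0]

theorem lintegral_exp_neg_logPotential_lt_top (hd : 1 ≤ d) (hε : 1 < ε) :
    ∫⁻ x : EuclideanSpace ℝ (Fin d), ENNReal.ofReal (Real.exp (-logPotential d ε x)) < ∞ := by
  have hm : MeasurableSet {x : EuclideanSpace ℝ (Fin d) | 2 < ‖x‖} :=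
    measurableSet_lt measurable_const measurable_norm
  rw [← lintegral_add_compl _ hm]
  refine ENNReal.add_lt_top.2 ⟨?_, ?_⟩
  · refine lt_of_le_of_lt (setLIntegral_mono' hm fun x hx => ENNReal.ofReal_le_ofReal
      (exp_neg_logPotential_le (by linarith) (by linarith [hx.out]))) ?_
    rw [lintegral_norm_gt hd hε one_lt_two]
    exact ENNReal.ofReal_lt_top
  · have hc : {x : EuclideanSpace ℝ (Fin d) | 2 < ‖x‖}ᶜ = Metric.closedBall 0 2 := by
      ext x; simp
    rw [hc]
    calc _ ≤ ∫⁻ _ in Metric.closedBall (0 : EuclideanSpace ℝ (Fin d)) 2, 1 :=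
          lintegral_mono fun x => by
            rw [ENNReal.ofReal_le_one, Real.exp_le_one_iff, neg_nonpos]
            exact logPotential_nonneg (by linarith) x
      _ < ∞ := by
        rw [setLIntegral_one]
        exact measure_closedBall_lt_top

theorem lintegral_exp_neg_logPotential_pos :
    ∫⁻ x : EuclideanSpace ℝ (Fin d), ENNReal.ofReal (Real.exp (-logPotential d ε x)) ≠ 0 := by
  rw [Ne, lintegral_eq_zero_iff (by have := measurable_logPotential (d := d) (ε := ε); fun_prop)]
  intro h
  have h1 : ∀ᵐ _ : EuclideanSpace ℝ (Fin d), False := by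
    filter_upwards [h] with x hx
    simp only [Pi.zero_apply, ENNReal.ofReal_eq_zero] at hx
    exact absurd (Real.exp_pos _) (not_lt.2 hx)
  exact h1.exists.elim fun _ h => h

theorem isProbabilityMeasure_mu_logPotential (hd : 1 ≤ d) (hε : 1 < ε) :
    IsProbabilityMeasure (mu (logPotential d ε)) := by
  refine ⟨?_⟩
  rw [mu, Measure.smul_apply, withDensity_apply _ MeasurableSet.univ, setLIntegral_univ,
    smul_eq_mul]
  exact ENNReal.inv_mul_cancel lintegral_exp_neg_logPotential_pos
    (lintegral_exp_neg_logPotential_lt_top hd hε).ne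

/-- Two-sided bounds for the tails of `μ_V`. -/
theorem exists_tail_bounds (hd : 1 ≤ d) (hε : 1 < ε) : ∃ a A : ℝ, 0 < a ∧ 0 < A ∧
    (∀ R, 2 ≤ R → ENNReal.ofReal (a * Real.log R ^ (1 - ε)) ≤
      mu (logPotential d ε) {x | R < ‖x‖}) ∧
    ∀ R, 1 < R → mu (logPotential d ε) {x | R < ‖x‖} ≤
      ENNReal.ofReal (A * Real.log R ^ (1 - ε)) := by
  have := nontrivial_euclideanSpace hd
  set Z := ∫⁻ x : EuclideanSpace ℝ (Fin d), ENNReal.ofReal (Real.exp (-logPotential d ε x)) with hZ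
  have hZtop : Z ≠ ∞ := (lintegral_exp_neg_logPotential_lt_top hd hε).ne
  have hZpos : 0 < Z.toReal := ENNReal.toReal_pos lintegral_exp_neg_logPotential_pos hZtop
  have hZinv : Z⁻¹ = ENNReal.ofReal Z.toReal⁻¹ := by
    rw [ENNReal.ofReal_inv_of_pos hZpos, ENNReal.ofReal_toReal hZtop]
  set K := d * volume.real (Metric.ball (0 : EuclideanSpace ℝ (Fin d)) 1) / (ε - 1) with hK
  have hvol : 0 < volume.real (Metric.ball (0 : EuclideanSpace ℝ (Fin d)) 1) :=
    ENNReal.toReal_pos (Metric.measure_ball_pos _ _ one_pos).ne' measure_ball_lt_top.ne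
  have hKpos : 0 < K := by
    have h1 : (0 : ℝ) < d := by exact_mod_cast hd
    have h2 : 0 < ε - 1 := by linarith
    positivity
  have hm : ∀ R : ℝ, MeasurableSet {x : EuclideanSpace ℝ (Fin d) | R < ‖x‖} := fun R =>
    measurableSet_lt measurable_const measurable_norm
  have hmu : ∀ R : ℝ, mu (logPotential d ε) {x | R < ‖x‖} = ENNReal.ofReal Z.toReal⁻¹ *
      ∫⁻ x in {x | R < ‖x‖}, ENNReal.ofReal (Real.exp (-logPotential d ε x)) := fun R => by
    rw [mu, Measure.smul_apply, withDensity_apply _ (hm R), smul_eq_mul, ← hZinv]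
  set b : ℝ := 2 ^ (-((d : ℝ) / 2)) * 3 ^ (-ε) with hb
  have hbpos : 0 < b := by positivity
  refine ⟨Z.toReal⁻¹ * (b * K), Z.toReal⁻¹ * K, by positivity, by positivity, fun R hR => ?_,
    fun R hR => ?_⟩
  · rw [hmu, mul_assoc, mul_assoc, ENNReal.ofReal_mul (by positivity), ENNReal.ofReal_mul hbpos.le,
      ← lintegral_norm_gt hd hε (by linarith), ← lintegral_const_mul' _ _ ENNReal.ofReal_ne_top]
    gcongr ENNReal.ofReal Z.toReal⁻¹ * ?_
    refine setLIntegral_mono' (hm R) fun x hx => ?_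
    rw [← ENNReal.ofReal_mul hbpos.le]
    exact ENNReal.ofReal_le_ofReal (le_exp_neg_logPotential (by linarith) (hR.trans_lt hx))
  · rw [hmu, mul_assoc, ENNReal.ofReal_mul (by positivity), ← lintegral_norm_gt hd hε hR]
    gcongr ENNReal.ofReal Z.toReal⁻¹ * ?_
    exact setLIntegral_mono' (hm R) fun x hx => ENNReal.ofReal_le_ofReal
      (exp_neg_logPotential_le (by linarith) (hR.trans hx))

end

/-! ### The weak Poincaré inequality -/

section Poincare

variable {d : ℕ} {α ε : ℝ} {V : EuclideanSpace ℝ (Fin d) → ℝ}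

/-- Allows `μ_V ⊗ μ_V` to be replaced by `Z⁻¹ μ_V(dx) dy`, the measure of the energy. -/
theorem mu_le_smul_volume (hV : ∀ x, 0 ≤ V x) :
    mu V ≤ (∫⁻ x, ENNReal.ofReal (Real.exp (-V x)))⁻¹ • volume := by
  rw [mu]
  gcongr
  conv_rhs => rw [← withDensity_one (μ := volume)]
  exact withDensity_mono (Eventually.of_forall fun x => by
    simpa using hV x)

/-- For a function of mean zero, the second moment is bounded by the mean square difference. -/
theorem lintegral_sq_le_lintegral_sub_sq [IsProbabilityMeasure (mu V)]
    {f : EuclideanSpace ℝ (Fin d) → ℝ} (hf : MemLp f 2 (mu V)) (h0 : ∫ x, f x ∂(mu V) = 0) :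
    ∫⁻ x, ENNReal.ofReal (f x ^ 2) ∂(mu V) ≤
      ∫⁻ p, ENNReal.ofReal ((f p.1 - f p.2) ^ 2) ∂((mu V).prod (mu V)) := by
  have hm : AEMeasurable (fun p : EuclideanSpace ℝ (Fin d) × EuclideanSpace ℝ (Fin d) =>
      ENNReal.ofReal ((f p.1 - f p.2) ^ 2)) ((mu V).prod (mu V)) :=
    ((hf.1.comp_fst.aemeasurable.sub hf.1.comp_snd.aemeasurable).pow_const 2).ennreal_ofReal
  rw [lintegral_prod _ hm]
  refine lintegral_mono fun x => ?_
  have hi1 : Integrable (fun y => 2 * f x * f y) (mu V) :=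
    (hf.integrable one_le_two).const_mul _
  have hi2 : Integrable (fun y => f y ^ 2) (mu V) := hf.integrable_sq
  have hi3 : Integrable (fun y => f x ^ 2 - 2 * f x * f y) (mu V) :=
    (integrable_const _).sub hi1
  have heq : ∀ y, (f x - f y) ^ 2 = f x ^ 2 - 2 * f x * f y + f y ^ 2 := fun y => by ring
  have hi : Integrable (fun y => (f x - f y) ^ 2) (mu V) := by
    simp_rw [heq]
    exact hi3.add hi2
  rw [← ofReal_integral_eq_lintegral_ofReal hi (Eventually.of_forall fun y => sq_nonneg _)]
  refine ENNReal.ofReal_le_ofReal ?_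
  simp_rw [heq]
  -- The cross term vanishes, so for each fixed `x` the integral over `y` is `f(x)² + μ_V(f²)`.
  rw [integral_add hi3 hi2, integral_sub (integrable_const _) hi1, integral_const_mul, h0]
  have := integral_nonneg (μ := mu V) (f := fun y => f y ^ 2) fun y => sq_nonneg _
  simpa using this

/-- A local Poincaré inequality on the ball of radius `R`, with the remainder controlled by the
mass outside of the ball. -/
theorem lintegral_sq_le_energy_add_tail [IsProbabilityMeasure (mu V)] (hα0 : 0 < α)
    (hV : ∀ x, 0 ≤ V x) {f : EuclideanSpace ℝ (Fin d) → ℝ} (hf : MemLp f 2 (mu V))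
    (h0 : ∫ x, f x ∂(mu V) = 0) {R : ℝ} (hR : 0 ≤ R) :
    ∫⁻ x, ENNReal.ofReal (f x ^ 2) ∂(mu V) ≤
      ENNReal.ofReal ((2 * R) ^ ((d : ℝ) + α)) *
        ((∫⁻ x, ENNReal.ofReal (Real.exp (-V x)))⁻¹ * energy α V f) +
      8 * mu V {x | R < ‖x‖} * eLpNorm f ∞ (mu V) ^ 2 := by
  set M := eLpNorm f ∞ (mu V) with hM
  set B := {x : EuclideanSpace ℝ (Fin d) | R < ‖x‖} with hB
  have hBm : MeasurableSet B := measurableSet_lt measurable_const measurable_norm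
  have hfM : ∀ᵐ x ∂(mu V), ‖f x‖ₑ ≤ M := by
    rw [hM, eLpNorm_exponent_top]
    exact ae_le_eLpNormEssSup
  set Φ : EuclideanSpace ℝ (Fin d) × EuclideanSpace ℝ (Fin d) → ℝ≥0∞ := fun p =>
    ENNReal.ofReal (|f p.1 - f p.2| ^ 2 / ‖p.1 - p.2‖ ^ ((d : ℝ) + α)) with hΦ
  have hpt : ∀ᵐ p ∂((mu V).prod (mu V)), ENNReal.ofReal ((f p.1 - f p.2) ^ 2) ≤
      ENNReal.ofReal ((2 * R) ^ ((d : ℝ) + α)) * Φ p +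
        (B.indicator (fun _ => 4 * M ^ 2) p.1 + B.indicator (fun _ => 4 * M ^ 2) p.2) := by
    filter_upwards [Measure.quasiMeasurePreserving_fst (μ := mu V) (ν := mu V) |>.ae hfM,
      Measure.quasiMeasurePreserving_snd (μ := mu V) (ν := mu V) |>.ae hfM] with p h1 h2
    -- If a point is outside the ball, the squared difference is at most `(2M)²`; two such
    -- contributions give the factor `8`. Otherwise `|x - y| ≤ 2R`.
    by_cases hp : R < ‖p.1‖ ∨ R < ‖p.2‖
    · have h3 : ENNReal.ofReal ((f p.1 - f p.2) ^ 2) ≤ 4 * M ^ 2 := by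
        calc ENNReal.ofReal ((f p.1 - f p.2) ^ 2) = ‖f p.1 - f p.2‖ₑ ^ 2 := by
              rw [← enorm_pow, Real.enorm_of_nonneg (sq_nonneg _)]
          _ ≤ (M + M) ^ 2 := by
              gcongr
              exact enorm_sub_le.trans (add_le_add h1 h2)
          _ = 4 * M ^ 2 := by ring
      refine h3.trans (le_trans ?_ le_add_self)
      rcases hp with hp | hp
      · refine le_trans ?_ le_self_add
        rw [Set.indicator_of_mem (show p.1 ∈ B from hp)]
      · refine le_trans ?_ le_add_self
        rw [Set.indicator_of_mem (show p.2 ∈ B from hp)]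
    · push Not at hp
      refine le_trans ?_ le_self_add
      simp only [hΦ]
      rw [← ENNReal.ofReal_mul (by positivity)]
      refine ENNReal.ofReal_le_ofReal ?_
      rw [sq_abs]
      rcases eq_or_ne p.1 p.2 with h | h
      · rw [h, sub_self, zero_pow two_ne_zero]
        positivity
      · have hpos : 0 < ‖p.1 - p.2‖ := norm_pos_iff.2 (sub_ne_zero.2 h)
        have hle : ‖p.1 - p.2‖ ≤ 2 * R := (norm_sub_le _ _).trans (by linarith [hp.1, hp.2])
        have hpow : ‖p.1 - p.2‖ ^ ((d : ℝ) + α) ≤ (2 * R) ^ ((d : ℝ) + α) :=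
          Real.rpow_le_rpow hpos.le hle (by positivity)
        have hpow0 : 0 < ‖p.1 - p.2‖ ^ ((d : ℝ) + α) := Real.rpow_pos_of_pos hpos _
        rw [mul_div_assoc', le_div_iff₀ hpow0, mul_comm]
        gcongr
  have hind1 : ∫⁻ p, B.indicator (fun _ => 4 * M ^ 2) p.1 ∂((mu V).prod (mu V)) =
      4 * M ^ 2 * mu V B := by
    rw [(measurePreserving_fst (μ := mu V) (ν := mu V)).lintegral_comp
      (f := B.indicator fun _ => 4 * M ^ 2) (measurable_const.indicator hBm),
      lintegral_indicator_const hBm]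
  have hind2 : ∫⁻ p, B.indicator (fun _ => 4 * M ^ 2) p.2 ∂((mu V).prod (mu V)) =
      4 * M ^ 2 * mu V B := by
    rw [(measurePreserving_snd (μ := mu V) (ν := mu V)).lintegral_comp
      (f := B.indicator fun _ => 4 * M ^ 2) (measurable_const.indicator hBm),
      lintegral_indicator_const hBm]
  have hΦle : ∫⁻ p, Φ p ∂((mu V).prod (mu V)) ≤
      (∫⁻ x, ENNReal.ofReal (Real.exp (-V x)))⁻¹ * energy α V f := by
    have h1 : (mu V).prod (mu V) ≤
        (∫⁻ x, ENNReal.ofReal (Real.exp (-V x)))⁻¹ • (mu V).prod volume := by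
      rw [← Measure.prod_smul_right]
      exact Measure.prod_mono le_rfl (mu_le_smul_volume hV)
    refine (lintegral_mono' h1 le_rfl).trans_eq ?_
    rw [lintegral_smul_measure]
    rfl
  have hm1 : Measurable fun p : EuclideanSpace ℝ (Fin d) × EuclideanSpace ℝ (Fin d) =>
      B.indicator (fun _ => 4 * M ^ 2) p.1 := (measurable_const.indicator hBm).comp measurable_fst
  have hm12 : Measurable fun p : EuclideanSpace ℝ (Fin d) × EuclideanSpace ℝ (Fin d) =>
      B.indicator (fun _ => 4 * M ^ 2) p.1 + B.indicator (fun _ => 4 * M ^ 2) p.2 :=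
    hm1.add ((measurable_const.indicator hBm).comp measurable_snd)
  calc ∫⁻ x, ENNReal.ofReal (f x ^ 2) ∂(mu V)
      ≤ ∫⁻ p, ENNReal.ofReal ((f p.1 - f p.2) ^ 2) ∂((mu V).prod (mu V)) :=
        lintegral_sq_le_lintegral_sub_sq hf h0
    _ ≤ _ := lintegral_mono_ae hpt
    _ = ENNReal.ofReal ((2 * R) ^ ((d : ℝ) + α)) * ∫⁻ p, Φ p ∂((mu V).prod (mu V)) +
          (4 * M ^ 2 * mu V B + 4 * M ^ 2 * mu V B) := by
        rw [lintegral_add_right _ hm12, lintegral_const_mul' _ _ ENNReal.ofReal_ne_top,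
          lintegral_add_left hm1, hind1, hind2]
    _ ≤ _ := by
        gcongr
        exact le_of_eq (by ring)

/-- The weak Poincaré inequality for the logarithmic potential. -/
theorem weakPoincare_logPotential (hd : 1 ≤ d) (hα0 : 0 < α) (hε : 1 < ε) :
    ∃ c₁ c₂ : ℝ, 0 < c₁ ∧ 0 < c₂ ∧ WeakPoincare α (logPotential d ε)
      (fun r => c₁ * Real.exp (c₂ * r ^ (-(1 / (ε - 1))))) := by
  have := isProbabilityMeasure_mu_logPotential hd hε
  obtain ⟨-, A, -, hA, -, htail⟩ := exists_tail_bounds hd hε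
  set Z := ∫⁻ x : EuclideanSpace ℝ (Fin d), ENNReal.ofReal (Real.exp (-logPotential d ε x)) with hZ
  have hZtop : Z ≠ ∞ := (lintegral_exp_neg_logPotential_lt_top hd hε).ne
  have hZpos : 0 < Z.toReal := ENNReal.toReal_pos lintegral_exp_neg_logPotential_pos hZtop
  have hZinv : Z⁻¹ = ENNReal.ofReal Z.toReal⁻¹ := by
    rw [ENNReal.ofReal_inv_of_pos hZpos, ENNReal.ofReal_toReal hZtop]
  have hε1 : 0 < ε - 1 := by linarith
  refine ⟨2 ^ ((d : ℝ) + α) * Z.toReal⁻¹, (8 * A) ^ (1 / (ε - 1)) * (d + α), by positivity,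
    by positivity, fun r hr f hf h0 => ?_⟩
  -- The ball has radius `e^l`, with `l` solving `8 A l^(1-ε) = r`, so that the tail term is at most
  -- `r ‖f‖_∞²`.
  set l : ℝ := (8 * A / r) ^ (1 / (ε - 1)) with hl
  have hlpos : 0 < l := by positivity
  have hlr : l = (8 * A) ^ (1 / (ε - 1)) * r ^ (-(1 / (ε - 1))) := by
    rw [hl, Real.div_rpow (by positivity) hr.le, Real.rpow_neg hr.le, div_eq_mul_inv]
  have hl2 : 8 * A * l ^ (1 - ε) = r := by
    rw [hl, ← Real.rpow_mul (by positivity), show 1 / (ε - 1) * (1 - ε) = -1 by field_simp; ring,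
      Real.rpow_neg_one]
    field_simp
  have key := lintegral_sq_le_energy_add_tail (R := Real.exp l) hα0
    (logPotential_nonneg (by linarith)) hf.1 h0 (Real.exp_pos l).le
  refine key.trans (add_le_add ?_ ?_)
  · rw [← hZ, hZinv, ← mul_assoc, ← ENNReal.ofReal_mul (by positivity)]
    gcongr
    refine le_of_eq ?_
    rw [Real.mul_rpow zero_le_two (Real.exp_pos l).le, ← Real.exp_mul, hlr]
    ring_nf
  · gcongr
    have h1 := htail (Real.exp l) (Real.one_lt_exp_iff.2 hlpos)
    rw [Real.log_exp] at h1
    calc 8 * mu (logPotential d ε) {x | Real.exp l < ‖x‖}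
        ≤ ENNReal.ofReal 8 * ENNReal.ofReal (A * l ^ (1 - ε)) := by
          rw [ENNReal.ofReal_ofNat]; gcongr
      _ = ENNReal.ofReal r := by
          rw [← ENNReal.ofReal_mul (by norm_num), ← mul_assoc, hl2]

end Poincare

/-! ### Sharpness, by testing on cutoffs -/

section Sharpness

variable {d : ℕ} {α ε : ℝ} {V : EuclideanSpace ℝ (Fin d) → ℝ}

/-- The cutoff that vanishes on the ball of radius `R` and is `1` outside the ball of radius
`2 R`. -/
def radialCutoff (d : ℕ) (R : ℝ) (x : EuclideanSpace ℝ (Fin d)) : ℝ :=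
  min 1 (max 0 (‖x‖ / R - 1))

theorem radialCutoff_nonneg (R : ℝ) (x : EuclideanSpace ℝ (Fin d)) : 0 ≤ radialCutoff d R x :=
  le_min zero_le_one (le_max_left _ _)

theorem radialCutoff_le_one (R : ℝ) (x : EuclideanSpace ℝ (Fin d)) : radialCutoff d R x ≤ 1 :=
  min_le_left _ _

theorem continuous_radialCutoff (R : ℝ) : Continuous (radialCutoff d R) := by
  unfold radialCutoff; fun_prop

theorem radialCutoff_eq_zero {R : ℝ} (hR : 0 < R) {x : EuclideanSpace ℝ (Fin d)} (hx : ‖x‖ ≤ R) :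
    radialCutoff d R x = 0 := by
  have : ‖x‖ / R ≤ 1 := (div_le_one hR).2 hx
  rw [radialCutoff, max_eq_left (by linarith), min_eq_right zero_le_one]

theorem radialCutoff_eq_one {R : ℝ} (hR : 0 < R) {x : EuclideanSpace ℝ (Fin d)}
    (hx : 2 * R ≤ ‖x‖) : radialCutoff d R x = 1 := by
  have : 2 ≤ ‖x‖ / R := (le_div_iff₀ hR).2 hx
  rw [radialCutoff, min_eq_left (le_max_of_le_right (by linarith))]

theorem abs_radialCutoff_sub_le {R : ℝ} (hR : 0 < R) (x y : EuclideanSpace ℝ (Fin d)) :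
    |radialCutoff d R x - radialCutoff d R y| ≤ 1 * min (‖x - y‖ / R) 1 := by
  rw [one_mul]
  refine le_min ?_ ?_
  · refine (abs_min_sub_min_le_max _ _ _ _).trans ?_
    rw [sub_self, abs_zero]
    refine max_le (by positivity) ((abs_max_sub_max_le_max _ _ _ _).trans ?_)
    rw [sub_self, abs_zero]
    refine max_le (by positivity) ?_
    rw [sub_sub_sub_cancel_right, ← sub_div, abs_div, abs_of_pos hR]
    gcongr
    exact abs_norm_sub_norm_le x y
  · rw [abs_le]
    constructor <;>
    linarith [radialCutoff_nonneg R x, radialCutoff_nonneg R y, radialCutoff_le_one R x,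
      radialCutoff_le_one R y]

/-- The weak Poincaré inequality tested on centred radial cutoffs. -/
theorem WeakPoincare.tail_le [IsProbabilityMeasure (mu V)] {β : ℝ → ℝ} (hW : WeakPoincare α V β)
    (hd : 1 ≤ d) (hα0 : 0 < α) (hα2 : α < 2) {r R : ℝ} (hr : 0 < r) (hβ : 0 < β r) (hR : 0 < R)
    (htail : mu V {x | R < ‖x‖} ≤ ENNReal.ofReal (1 / 2)) :
    ENNReal.ofReal (1 / 4) * mu V {x | 2 * R < ‖x‖} ≤
      ENNReal.ofReal (β r * (R ^ (-α) * ∫ z, truncatedKernel d α z) + r) := by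
  set χ := radialCutoff d R with hχ
  set m := ∫ x, χ x ∂(mu V) with hm
  set f : EuclideanSpace ℝ (Fin d) → ℝ := fun x => χ x - m with hf
  have hB : MeasurableSet {x : EuclideanSpace ℝ (Fin d) | R < ‖x‖} :=
    measurableSet_lt measurable_const measurable_norm
  have hB2 : MeasurableSet {x : EuclideanSpace ℝ (Fin d) | 2 * R < ‖x‖} :=
    measurableSet_lt measurable_const measurable_norm
  have hχb : ∀ x, ‖χ x‖ ≤ 1 := fun x => by
    rw [Real.norm_of_nonneg (radialCutoff_nonneg R x)]; exact radialCutoff_le_one R x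
  have hχi : Integrable χ (mu V) :=
    .of_bound (continuous_radialCutoff R).aestronglyMeasurable 1 (Eventually.of_forall hχb)
  have hm0 : 0 ≤ m := integral_nonneg (radialCutoff_nonneg R)
  -- Hence `f ≥ 1/2` where the cutoff equals one, which is the source of the factor `1/4`.
  have hm1 : m ≤ 1 / 2 := by
    have h1 : m ≤ ∫ x, {x | R < ‖x‖}.indicator (fun _ => (1 : ℝ)) x ∂(mu V) := by
      refine integral_mono hχi ((integrable_const 1).indicator hB) fun x => ?_
      rw [Set.indicator_apply]
      split_ifs with h
      · exact radialCutoff_le_one R x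
      · exact (radialCutoff_eq_zero hR (not_lt.1 h)).le
    rw [integral_indicator_const _ hB, smul_eq_mul, mul_one] at h1
    exact h1.trans (ENNReal.toReal_le_of_le_ofReal (by norm_num) htail)
  have hfb : ∀ x, ‖f x‖ ≤ 1 := fun x => by
    rw [Real.norm_eq_abs, abs_le]
    constructor <;> simp only [hf] <;>
    linarith [radialCutoff_nonneg R x, radialCutoff_le_one R x]
  have hfe : energy α V f ≤ ENNReal.ofReal (R ^ (-α) * ∫ z, truncatedKernel d α z) := by
    have := energy_le_of_abs_sub_le (V := V) (f := f) (C := 1) hd hα0 hα2 hR fun x y => by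
      simp only [hf, sub_sub_sub_cancel_right]
      exact abs_radialCutoff_sub_le hR x y
    rwa [one_pow, one_mul] at this
  have hfd : InDomain α V f := ⟨.of_bound
    ((continuous_radialCutoff R).sub continuous_const).aestronglyMeasurable 1
    (Eventually.of_forall hfb), hfe.trans_lt ENNReal.ofReal_lt_top⟩
  have hf0 : ∫ x, f x ∂(mu V) = 0 := by
    simp only [hf]
    rw [integral_sub hχi (integrable_const _)]
    simp [hm]
  have hfn : eLpNorm f ∞ (mu V) ≤ 1 := by
    rw [eLpNorm_exponent_top]
    have := eLpNormEssSup_le_of_ae_bound (μ := mu V) (Eventually.of_forall hfb)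
    rwa [ENNReal.ofReal_one] at this
  have hκ : 0 ≤ ∫ z, truncatedKernel d α z := integral_nonneg truncatedKernel_nonneg
  calc ENNReal.ofReal (1 / 4) * mu V {x | 2 * R < ‖x‖}
      = ∫⁻ x, {x | 2 * R < ‖x‖}.indicator (fun _ => ENNReal.ofReal (1 / 4)) x ∂(mu V) := by
        rw [lintegral_indicator_const hB2]
    _ ≤ ∫⁻ x, ENNReal.ofReal (f x ^ 2) ∂(mu V) := by
        refine lintegral_mono fun x => ?_
        rw [Set.indicator_apply]
        split_ifs with h
        · refine ENNReal.ofReal_le_ofReal ?_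
          simp only [hf]
          rw [hχ, radialCutoff_eq_one hR (le_of_lt h)]
          nlinarith
        · exact zero_le
    _ ≤ ENNReal.ofReal (β r) * energy α V f + ENNReal.ofReal r * eLpNorm f ∞ (mu V) ^ 2 :=
        hW r hr f hfd hf0
    _ ≤ ENNReal.ofReal (β r) * ENNReal.ofReal (R ^ (-α) * ∫ z, truncatedKernel d α z) +
          ENNReal.ofReal r * 1 ^ 2 := by gcongr
    _ = _ := by
        rw [one_pow, mul_one, ← ENNReal.ofReal_mul hβ.le, ← ENNReal.ofReal_add _ hr.le]
        positivity

/-- The rate in the weak Poincaré inequality for the logarithmic potential is sharp. -/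
theorem not_weakPoincare_logPotential (hd : 1 ≤ d) (hα0 : 0 < α) (hα2 : α < 2) (hε : 1 < ε)
    {β : ℝ → ℝ} (hβ : ∀ r : ℝ, 0 < r → 0 < β r)
    (hlim : Tendsto (fun r : ℝ => r ^ (1 / (ε - 1)) * Real.log (β r)) (𝓝[>] 0) (𝓝 0)) :
    ¬ WeakPoincare α (logPotential d ε) β := by
  intro hW
  have := isProbabilityMeasure_mu_logPotential hd hε
  obtain ⟨a, A, ha, hA, hlow, hup⟩ := exists_tail_bounds hd hε
  have hε1 : 0 < ε - 1 := by linarith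
  set κ := ∫ z, truncatedKernel d α z with hκ
  have hκ0 : 0 ≤ κ := integral_nonneg truncatedKernel_nonneg
  -- The quarter from the test function and `log (2 e^l) ≤ 2 l` make the left side at least `a'
  -- l^(1-ε)`. The constant `b` is such that this equals `2r` for `l = b r^(-q)`, so one `r` remains
  -- after absorbing the error term.
  set a' := a * 2 ^ (1 - ε) / 4 with ha'
  have ha'0 : 0 < a' := by positivity
  set q := 1 / (ε - 1) with hq
  have hq0 : 0 < q := by positivity
  set b := (a' / 2) ^ q with hb
  have hb0 : 0 < b := by positivity
  have key : ∀ r : ℝ, 0 < r → r ≤ a' / 2 → r ≤ a' / (4 * A) →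
      r ≤ β r * (Real.exp (-(α * (b * r ^ (-q)))) * κ) := by
    intro r hr hr1 hr2
    set l := b * r ^ (-q) with hl
    have hl1 : l = (a' / 2 / r) ^ q := by
      rw [hl, hb, Real.div_rpow (by positivity) hr.le, Real.rpow_neg hr.le, ← div_eq_mul_inv]
    have hl2 : l ^ (1 - ε) = 2 * r / a' := by
      rw [hl1, ← Real.rpow_mul (by positivity), show q * (1 - ε) = -1 by rw [hq]; field_simp; ring,
        Real.rpow_neg_one]
      field_simp
    have hl3 : 1 ≤ l := by
      rw [hl1]
      exact Real.one_le_rpow ((one_le_div hr).2 hr1) hq0.le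
    have hexp2 : 2 ≤ Real.exp l := by linarith [Real.add_one_le_exp l]
    have htail : mu (logPotential d ε) {x | Real.exp l < ‖x‖} ≤ ENNReal.ofReal (1 / 2) := by
      refine (hup _ (by linarith)).trans (ENNReal.ofReal_le_ofReal ?_)
      rw [Real.log_exp, hl2]
      rw [le_div_iff₀ (by positivity)] at hr2
      rw [mul_div_assoc', div_le_iff₀ ha'0]
      linarith
    have h1 := hW.tail_le hd hα0 hα2 hr (hβ r hr) (Real.exp_pos l) htail
    have h2 := hlow (2 * Real.exp l) (by linarith)
    have h3 : ENNReal.ofReal (1 / 4 * (a * Real.log (2 * Real.exp l) ^ (1 - ε))) ≤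
        ENNReal.ofReal (β r * (Real.exp l ^ (-α) * κ) + r) := by
      rw [ENNReal.ofReal_mul (by norm_num)]
      exact (mul_le_mul_right h2 _).trans h1
    have hβr := hβ r hr
    rw [ENNReal.ofReal_le_ofReal_iff (by positivity)] at h3
    have h4 : (2 * l) ^ (1 - ε) ≤ Real.log (2 * Real.exp l) ^ (1 - ε) := by
      rw [Real.log_mul two_ne_zero (Real.exp_pos l).ne', Real.log_exp]
      have h5 := Real.log_pos one_lt_two
      have h6 := Real.log_two_lt_d9
      exact Real.rpow_le_rpow_of_nonpos (by linarith) (by linarith) (by linarith)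
    rw [Real.mul_rpow zero_le_two (by linarith), hl2] at h4
    have h7 : 1 / 4 * (a * (2 ^ (1 - ε) * (2 * r / a'))) = 2 * r := by
      rw [ha']; field_simp
    have h8 := mul_le_mul_of_nonneg_left (mul_le_mul_of_nonneg_left h4 ha.le)
      (show (0 : ℝ) ≤ 1 / 4 by norm_num)
    rw [h7] at h8
    rw [← Real.exp_mul, mul_neg, mul_comm l α] at h3
    linarith
  -- Take logarithms in `key` and multiply by `r^q`. The left side tends to `α b > 0`, whereas the
  -- right side is assumed to tend to zero.
  have hlower : ∀ᶠ r in 𝓝[>] (0 : ℝ),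
      Real.log r * r ^ q + α * b - r ^ q * Real.log κ ≤ r ^ q * Real.log (β r) := by
    have h1 : ∀ᶠ r in 𝓝[>] (0 : ℝ), r < min (a' / 2) (a' / (4 * A)) :=
      mem_nhdsWithin_of_mem_nhds (gt_mem_nhds (by positivity))
    filter_upwards [h1, self_mem_nhdsWithin] with r hr1 hr
    have hr0 : 0 < r := hr
    have h2 := key r hr0 (hr1.le.trans (min_le_left _ _)) (hr1.le.trans (min_le_right _ _))
    have hκpos : 0 < κ := by
      refine lt_of_le_of_ne hκ0 fun h => ?_
      rw [← h] at h2
      linarith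
    have h3 := Real.log_le_log hr0 h2
    rw [Real.log_mul (hβ r hr0).ne' (by positivity), Real.log_mul (Real.exp_pos _).ne' hκpos.ne',
      Real.log_exp] at h3
    have hρ : 0 < r ^ q := Real.rpow_pos_of_pos hr0 q
    have h4 := mul_le_mul_of_nonneg_left h3 hρ.le
    have h5 : r ^ q * (Real.log (β r) + (-(α * (b * r ^ (-q))) + Real.log κ)) =
        r ^ q * Real.log (β r) - α * b + r ^ q * Real.log κ := by
      have h6 : r ^ q * r ^ (-q) = 1 := by
        rw [← Real.rpow_add hr0, add_neg_cancel, Real.rpow_zero]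
      linear_combination (-α * b) * h6
    rw [h5] at h4
    linarith
  have hlimlow : Tendsto (fun r : ℝ => Real.log r * r ^ q + α * b - r ^ q * Real.log κ)
      (𝓝[>] 0) (𝓝 (0 + α * b - 0 ^ q * Real.log κ)) := by
    refine ((tendsto_log_mul_rpow_nhdsGT_zero hq0).add_const _).sub (Tendsto.mul_const _ ?_)
    exact (Real.continuousAt_rpow_const 0 q (Or.inr hq0.le)).tendsto.mono_left nhdsWithin_le_nhds
  rw [Real.zero_rpow hq0.ne', zero_mul, zero_add, sub_zero] at hlimlow
  have := le_of_tendsto_of_tendsto hlimlow hlim hlower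
  have := mul_pos hα0 hb0
  linarith

end Sharpness

/-! ### Optimization of the level `r` in time -/

theorem rpow_le_mul_exp {p y : ℝ} (hp : 0 < p) (hy : 0 ≤ y) : y ^ p ≤ p ^ p * Real.exp y := by
  have h1 : y ≤ p * Real.exp (y / p) := by
    have := Real.add_one_le_exp (y / p)
    calc y = p * (y / p) := by field_simp
      _ ≤ p * Real.exp (y / p) := by gcongr; linarith
  calc y ^ p ≤ (p * Real.exp (y / p)) ^ p := by gcongr
    _ = p ^ p * Real.exp y := by
      rw [Real.mul_rpow hp.le (Real.exp_pos _).le, ← Real.exp_mul, div_mul_cancel₀ _ hp.ne']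

/-- With the rate function equal to `c √(1+t)`, the exponential decays like `e^(-√(1+t)/c)` for `t ≥
1`, since `1 + t ≤ 2t`, and beats any power of the logarithm. For `t ≤ 1` both factors are at most
one. -/
theorem exp_neg_mul_log_rpow_le {c p t : ℝ} (hc : 0 < c) (hp : 0 < p) (ht : 0 < t) :
    Real.exp (-(2 * t / (c * Real.exp (Real.log (1 + t) / 2)))) * Real.log (1 + t) ^ p ≤
      1 + (2 * c) ^ p * p ^ p := by
  set l := Real.log (1 + t) with hl
  have hl0 : 0 < l := Real.log_pos (by linarith)
  have hexp : Real.exp (l / 2) * Real.exp (l / 2) = 1 + t := by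
    rw [← Real.exp_add, add_halves, hl, Real.exp_log (by linarith)]
  have hpos := Real.exp_pos (l / 2)
  rcases le_total t 1 with h | h
  · have h1 : l ≤ 1 := (Real.log_le_sub_one_of_pos (by linarith)).trans (by linarith)
    have h2 : l ^ p ≤ 1 := Real.rpow_le_one hl0.le h1 hp.le
    have h3 : Real.exp (-(2 * t / (c * Real.exp (l / 2)))) ≤ 1 := by
      rw [Real.exp_le_one_iff, neg_nonpos]; positivity
    have h4 : 0 ≤ (2 * c) ^ p * p ^ p := by positivity
    have h5 := mul_le_mul h3 h2 (by positivity) zero_le_one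
    linarith
  · set y := Real.exp (l / 2) / c with hy
    have hy0 : 0 < y := by positivity
    have h1 : y ≤ 2 * t / (c * Real.exp (l / 2)) := by
      rw [hy, div_le_div_iff₀ hc (by positivity)]
      nlinarith
    have h2 : l ≤ 2 * c * y := by
      have h3 : 2 * c * y = 2 * Real.exp (l / 2) := by rw [hy]; field_simp
      rw [h3]
      linarith [Real.add_one_le_exp (l / 2)]
    calc Real.exp (-(2 * t / (c * Real.exp (l / 2)))) * l ^ p
        ≤ Real.exp (-y) * (2 * c * y) ^ p := by gcongr
      _ = (2 * c) ^ p * (Real.exp (-y) * y ^ p) := by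
          rw [Real.mul_rpow (by positivity) hy0.le]; ring
      _ ≤ (2 * c) ^ p * (Real.exp (-y) * (p ^ p * Real.exp y)) := by
          gcongr; exact rpow_le_mul_exp hp hy0.le
      _ = (2 * c) ^ p * p ^ p := by
          rw [mul_left_comm (Real.exp (-y)), ← Real.exp_add, neg_add_cancel, Real.exp_zero, mul_one]
      _ ≤ _ := by linarith

/-- Logarithmic decay of the semigroup from the decay bounds at each level `r`. -/
theorem exists_log_decay {ε c₁ c₂ : ℝ} (hε : 1 < ε) (hc₁ : 0 < c₁) (hc₂ : 0 < c₂) :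
    ∃ C : ℝ, 0 < C ∧ ∀ t : ℝ, 0 < t → ∃ r : ℝ, 0 < r ∧
      4 * Real.exp (-(2 * t / (c₁ * Real.exp (c₂ * r ^ (-(1 / (ε - 1))))))) + 4 * r ≤
        C * Real.log (1 + t) ^ (1 - ε) := by
  have hp : 0 < ε - 1 := by linarith
  refine ⟨4 * (1 + (2 * c₁) ^ (ε - 1) * (ε - 1) ^ (ε - 1)) + 4 * (2 * c₂) ^ (ε - 1), by positivity,
    fun t ht => ?_⟩
  set l := Real.log (1 + t) with hl
  have hl0 : 0 < l := Real.log_pos (by linarith)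
  -- This `r` solves `c₂ r^(-1/(ε-1)) = l / 2`, so the rate function equals `c₁ √(1+t)`, and `r`
  -- itself is a multiple of `l^(1-ε)`.
  refine ⟨(2 * c₂ / l) ^ (ε - 1), by positivity, ?_⟩
  have h1 : c₂ * ((2 * c₂ / l) ^ (ε - 1)) ^ (-(1 / (ε - 1))) = l / 2 := by
    rw [← Real.rpow_mul (by positivity), show (ε - 1) * -(1 / (ε - 1)) = -1 by field_simp,
      Real.rpow_neg_one]
    field_simp
  have h2 : l ^ (1 - ε) * l ^ (ε - 1) = 1 := by
    rw [← Real.rpow_add hl0]; simp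
  have h3 := mul_le_mul_of_nonneg_left (exp_neg_mul_log_rpow_le hc₁ hp ht)
    (show 0 ≤ l ^ (1 - ε) by positivity)
  have h4 : (2 * c₂ / l) ^ (ε - 1) = (2 * c₂) ^ (ε - 1) * l ^ (1 - ε) := by
    rw [Real.div_rpow (by positivity) hl0.le, div_eq_mul_inv, ← Real.rpow_neg hl0.le, neg_sub]
  rw [← hl, mul_left_comm, h2, mul_one] at h3
  rw [h1, h4]
  linarith

end StableLike

end

theorem corollary1p4 (d : ℕ) (hd : 1 ≤ d) (α : ℝ) (hα0 : 0 < α) (hα2 : α < 2)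
    (ε : ℝ) (hε : 1 < ε) :
    IsProbabilityMeasure (StableLike.mu (StableLike.logPotential d ε)) ∧
    (∃ c₁ c₂ : ℝ, 0 < c₁ ∧ 0 < c₂ ∧
      StableLike.WeakPoincare α (StableLike.logPotential d ε)
        (fun r => c₁ * Real.exp (c₂ * r ^ (-(1 / (ε - 1)))))) ∧
    (∃ P : ℝ≥0 → Lp ℝ 2 (StableLike.mu (StableLike.logPotential d ε)) →L[ℝ]
          Lp ℝ 2 (StableLike.mu (StableLike.logPotential d ε)),
      StableLike.IsAssociatedSemigroup α (StableLike.logPotential d ε) P ∧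
      (∀ Q, StableLike.IsAssociatedSemigroup α (StableLike.logPotential d ε) Q → Q = P) ∧
      ∃ C : ℝ, 0 < C ∧ ∀ t : ℝ≥0, 0 < t →
        StableLike.normSubMean (StableLike.logPotential d ε) (P t) ^ 2 ≤
          ENNReal.ofReal (C * Real.log (1 + (t : ℝ)) ^ (1 - ε))) ∧
    (∀ β : ℝ → ℝ, (∀ r : ℝ, 0 < r → 0 < β r) →
      Tendsto (fun r : ℝ => r ^ (1 / (ε - 1)) * Real.log (β r)) (𝓝[>] 0) (𝓝 0) →
      ¬ StableLike.WeakPoincare α (StableLike.logPotential d ε) β) := by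
  have hprob := StableLike.isProbabilityMeasure_mu_logPotential hd hε
  obtain ⟨c₁, c₂, hc₁, hc₂, hW⟩ := StableLike.weakPoincare_logPotential hd hα0 hε
  obtain ⟨P, hP, huniq, hdecay⟩ :=
    StableLike.exists_isAssociatedSemigroup
      (StableLike.measurable_logPotential (d := d) (ε := ε)) hd hα0 hα2
  obtain ⟨C, hC, hCt⟩ := StableLike.exists_log_decay hε hc₁ hc₂
  refine ⟨hprob, ⟨c₁, c₂, hc₁, hc₂, hW⟩, ⟨P, hP, huniq, C, hC, fun t ht => ?_⟩,
    fun β hβ hlim => StableLike.not_weakPoincare_logPotential hd hα0 hα2 hε hβ hlim⟩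
  obtain ⟨r, hr, hle⟩ := hCt t ht
  exact (hdecay _ hW r hr (by positivity) t).trans (ENNReal.ofReal_le_ofReal hle)
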